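/- **Definitions.** A *bounded archimedean $\ell$-algebra* is a commutative unital $\mathbb R$-algebra $A$ with a lattice order such that $a\le b$ implies $a+c\le b+c$; $0\le a,b$ implies $0\le ab$; $0\le r\in\mathbb R$ and $0\le a$ imply $0\le ra$; for each $a\in A$ there is $n\in\mathbb N$ with $a\le n\cdot 1$; and if $na\le b$ for all $n\in\mathbb N$, then $a\le 0$. Morphisms are the unital $\mathbb R$-algebra homomorphisms that are also lattice homomorphisms. Put $|a|=a\vee(-a)$, $a^+=a\vee 0$ and $\|a\|=\inf\{r\in\mathbb R : |a|\le r\cdot 1\}$ (with $\|0\|=0$ if $A=0$). An *$\ell$-ideal* of $A$ is an ideal $I$ such that $|a|\le|b|$ and $b\in I$ imply $a\in I$; it is *archimedean* if $A/I$ is archimedean. The *Yosida space* $Y_A$ is the set of maximal (proper) $\ell$-ideals of $A$, whose closed sets are exactly the sets $\{M\in Y_A : I\subseteq M\}$ for $I$ an $\ell$-ideal. A morphism $\alpha:A\to B$ induces $Y(\alpha):Y_B\to Y_A$, $M\mapsto\alpha^{-1}(M)$. For $a\in A$ and $M\in Y_A$, $\zeta_A(a)(M)$ is the unique real number $r$ with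 $a-r\cdot 1\in M$. Let $w_A(a)=\max\{\|a\|,1\}$, and let $f_A:A\to F(A)$ be the free bounded archimedean $\ell$-algebra over the weighted set $(A,w_A)$: $F(A)$ is a bounded archimedean $\ell$-algebra, $\|f_A(a)\|\le w_A(a)$ for all $a\in A$, and each map $\varphi$ from $A$ to a bounded archimedean $\ell$-algebra $B$ with $\|\varphi(a)\|\le w_A(a)$ for all $a$ factors as $\varphi=\alpha\circ f_A$ for a unique morphism $\alpha:F(A)\to B$. Let $H(A)=F(A)/I_A$, where $I_A$ is the least archimedean $\ell$-ideal of $F(A)$ that contains, for all $a,b\in A$ and $r\in\mathbb R$, the elements $f_A(a\wedge b)-f_A(a)\wedge f_A(b)$; $f_A(r)-r-(1-r)f_A(0)$; $f_A(a^+)-f_A(a)^+$; $f_A(a+r)-f_A(a)-f_A(r)+f_A(0)$; and, if $r\ge0$, $f_A(ra)-f_A(r)f_A(a)$. Let $\Box_a\in H(A)$ be the class of $f_A(a)$. For a compact Hausdorff space $X$, let $C(X)$ be the algebra of continuous real-valued functions on $X$, and let $\varepsilon_X:X\to Y_{C(X)}$, $\varepsilon_X(x)=\{f\in C(X): f(x)=0\}$.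 Let $V(X)$ be the set of all closed subsets of $X$, including $\varnothing$, with the Vietoris topology, i.e. the topology with subbasis the sets $\{F: F\subseteq U\}$ and $\{F: F\cap U\neq\varnothing\}$ for $U$ open in $X$. **Theorem.** Let $A$ be a bounded archimedean $\ell$-algebra. Then the Yosida space $Y_{H(A)}$ is homeomorphic to the Vietoris space $V(Y_A)$. More precisely, there is a unique morphism $\eta_A:H(A)\to C(V(Y_A))$ of bounded archimedean $\ell$-algebras such that for all $a\in A$ and $F\in V(Y_A)$ $$\eta_A(\Box_a)(F)=\begin{cases}\inf\zeta_A(a)(F)&\text{if }F\ne\varnothing,\\ 1&\text{if }F=\varnothing,\end{cases}$$ and the maps $Y(\eta_A):Y_{C(V(Y_A))}\to Y_{H(A)}$ and $Y(\eta_A)\circ\varepsilon_{V(Y_A)}:V(Y_A)\to Y_{H(A)}$ are homeomorphisms. -/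

import Mathlib

open scoped NNReal

set_option linter.unusedSectionVars false
set_option linter.style.haveILetI false

noncomputable section

namespace BalAlg

universe u v

/-! ### Bounded archimedean l-algebras -/

/-- A bounded archimedean lattice-ordered (commutative, unital) real algebra.
The clause `0 ≤ 1` contained in `IsOrderedRing` is automatic, since `1` is a strong order unit. -/
class IsBal (A : Type*) [CommRing A] [Lattice A] [Algebra ℝ A] : Prop extends
    IsOrderedRing A where
  smul_nonneg' : ∀ (r : ℝ) (a : A), 0 ≤ r → 0 ≤ a → 0 ≤ r • a
  bounded' : ∀ a : A, ∃ n : ℕ, a ≤ n • (1 : A)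
  archimedean' : ∀ a b : A, (∀ n : ℕ, n • a ≤ b) → a ≤ 0

/-- Unital l-algebra morphisms: maps that are both unital real algebra homomorphisms and lattice
homomorphisms. -/
structure BalHom (A B : Type*) [CommRing A] [Lattice A] [Algebra ℝ A]
    [CommRing B] [Lattice B] [Algebra ℝ B] extends A →ₐ[ℝ] B where
  map_sup' : ∀ a b : A, toFun (a ⊔ b) = toFun a ⊔ toFun b
  map_inf' : ∀ a b : A, toFun (a ⊓ b) = toFun a ⊓ toFun b

instance {A B : Type*} [CommRing A] [Lattice A] [Algebra ℝ A]
    [CommRing B] [Lattice B] [Algebra ℝ B] : CoeFun (BalHom A B) (fun _ => A → B) :=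
  ⟨fun α => α.toAlgHom⟩

/-- The norm `‖a‖ = inf {r ∈ ℝ | |a| ≤ r · 1}`. -/
def balNorm {A : Type*} [CommRing A] [Lattice A] [Algebra ℝ A] (a : A) : ℝ :=
  sInf {r : ℝ | |a| ≤ algebraMap ℝ A r}

/-- An ideal `I` is an l-ideal if `|a| ≤ |b|` and `b ∈ I` imply `a ∈ I`. -/
class IsLIdeal {A : Type*} [CommRing A] [Lattice A] (I : Ideal A) : Prop where
  solid : ∀ a b : A, |a| ≤ |b| → b ∈ I → a ∈ I

section Basic

variable {A : Type*} [CommRing A] [Lattice A] [Algebra ℝ A] [IsBal A]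

theorem algebraMap_nonneg {r : ℝ} (hr : 0 ≤ r) : (0 : A) ≤ algebraMap ℝ A r := by
  rw [Algebra.algebraMap_eq_smul_one]
  exact IsBal.smul_nonneg' r 1 hr zero_le_one

theorem algebraMap_mono {r s : ℝ} (h : r ≤ s) : algebraMap ℝ A r ≤ algebraMap ℝ A s := by
  have := algebraMap_nonneg (A := A) (sub_nonneg.2 h)
  rwa [map_sub, sub_nonneg] at this

theorem abs_bounded (a : A) : ∃ r : ℝ, 0 ≤ r ∧ |a| ≤ algebraMap ℝ A r := by
  obtain ⟨n, hn⟩ := IsBal.bounded' |a|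
  exact ⟨n, n.cast_nonneg, by simpa using hn⟩

theorem balNorm_le {a : A} {r : ℝ} (hr : 0 ≤ r) (h : |a| ≤ algebraMap ℝ A r) :
    balNorm a ≤ r := by
  unfold balNorm
  by_cases hb : BddBelow {r : ℝ | |a| ≤ algebraMap ℝ A r}
  · exact csInf_le hb h
  · rw [Real.sInf_of_not_bddBelow hb]; exact hr

theorem abs_le_balNorm_add (a : A) {ε : ℝ} (hε : 0 < ε) :
    |a| ≤ algebraMap ℝ A (balNorm a + ε) := by
  obtain ⟨r, -, hr⟩ := abs_bounded a
  obtain ⟨s, hs, hlt⟩ := Real.lt_sInf_add_pos (s := {r : ℝ | |a| ≤ algebraMap ℝ A r}) ⟨r, hr⟩ hε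
  exact le_trans hs (algebraMap_mono hlt.le)

theorem nonneg_of_two_nsmul {a : A} (h : 0 ≤ a + a) : 0 ≤ a := by
  have h2 := IsBal.smul_nonneg' (1 / 2 : ℝ) _ (by norm_num) h
  rwa [← two_smul ℝ a, smul_smul, show (1 / 2 : ℝ) * 2 = 1 by norm_num, one_smul] at h2

theorem mul_le_abs (a b : A) : a * b ≤ |a| * |b| := by
  have h1 : 0 ≤ |a| - a := sub_nonneg.2 (le_abs_self a)
  have h2 : 0 ≤ |a| + a := by
    have := neg_le_abs a
    rw [neg_le_iff_add_nonneg] at this; exact this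
  have h3 : 0 ≤ |b| - b := sub_nonneg.2 (le_abs_self b)
  have h4 : 0 ≤ |b| + b := by
    have := neg_le_abs b
    rw [neg_le_iff_add_nonneg] at this; exact this
  have h5 := add_nonneg (mul_nonneg h1 h4) (mul_nonneg h2 h3)
  rw [← sub_nonneg]
  apply nonneg_of_two_nsmul
  convert h5 using 1
  ring

theorem abs_mul_le (a b : A) : |a * b| ≤ |a| * |b| := by
  refine sup_le (mul_le_abs a b) ?_
  have := mul_le_abs (-a) b
  rwa [neg_mul, abs_neg] at this

/-- In a bounded l-algebra, a solid additive subgroup is an ideal. -/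
def solidIdeal (S : Set A) (h0 : (0 : A) ∈ S) (hadd : ∀ a ∈ S, ∀ b ∈ S, a + b ∈ S)
    (hs : ∀ a b : A, |a| ≤ |b| → b ∈ S → a ∈ S) : Ideal A where
  carrier := S
  zero_mem' := h0
  add_mem' {a b} ha hb := hadd a ha b hb
  smul_mem' c x hx := by
    obtain ⟨n, hn⟩ := IsBal.bounded' |c|
    have hn' : ∀ n : ℕ, n • |x| ∈ S := by
      intro n
      induction n with
      | zero => simpa using h0
      | succ k ih =>
        rw [succ_nsmul]
        exact hadd _ ih _ (hs _ x (by rw [abs_abs]) hx)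
    refine hs _ _ ?_ (hn' n)
    have h1 : 0 ≤ n • |x| := nsmul_nonneg (abs_nonneg x) n
    rw [abs_of_nonneg h1, smul_eq_mul]
    calc |c * x| ≤ |c| * |x| := abs_mul_le c x
      _ ≤ (n • (1 : A)) * |x| := mul_le_mul_of_nonneg_right hn (abs_nonneg x)
      _ = n • |x| := by simp

theorem isLIdeal_solidIdeal (S : Set A) (h0 hadd hs) : IsLIdeal (solidIdeal S h0 hadd hs) :=
  ⟨fun a b h hb => hs a b h hb⟩

theorem LIdeal.mem_of_le {I : Ideal A} (hI : IsLIdeal I) {a b : A} (ha : 0 ≤ a) (h : a ≤ b)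
    (hb : b ∈ I) : a ∈ I :=
  hI.solid a b (by rwa [abs_of_nonneg ha, abs_of_nonneg (ha.trans h)]) hb

theorem LIdeal.abs_mem {I : Ideal A} (hI : IsLIdeal I) {a : A} : |a| ∈ I ↔ a ∈ I :=
  ⟨fun h => hI.solid _ _ (by rw [abs_abs]) h, fun h => hI.solid _ _ (by rw [abs_abs]) h⟩

end Basic

/-! ### The Yosida space -/

/-- Maximal l-ideals: the maximal elements among the proper l-ideals. -/
def IsMaxLIdeal {A : Type*} [CommRing A] [Lattice A] (M : Ideal A) : Prop :=
  Maximal (fun I : Ideal A => IsLIdeal I ∧ I ≠ ⊤) M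

/-- The underlying set of the Yosida space of `A`: the maximal l-ideals of `A`. -/
def Yosida (A : Type*) [CommRing A] [Lattice A] : Type _ :=
  {M : Ideal A // IsMaxLIdeal M}

/-- `Z(I) = {M ∈ Y_A | I ⊆ M}`. -/
def Yosida.zeroSet {A : Type*} [CommRing A] [Lattice A] (I : Ideal A) : Set (Yosida A) :=
  {M | I ≤ M.1}

section Yosida

variable {A : Type*} [CommRing A] [Lattice A] [Algebra ℝ A] [IsBal A]

theorem add_inf_le {a b c : A} (ha : 0 ≤ a) (hb : 0 ≤ b) (hc : 0 ≤ c) :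
    (a + b) ⊓ c ≤ a ⊓ c + b ⊓ c := by
  rw [add_inf, inf_add, inf_add]
  refine le_inf (le_inf inf_le_left ?_) (le_inf ?_ ?_)
  · exact inf_le_right.trans (le_add_of_nonneg_right hb)
  · exact inf_le_right.trans (le_add_of_nonneg_left ha)
  · exact inf_le_right.trans (le_add_of_nonneg_right hc)

/-- The polar of a set. -/
def polar (S : Set A) : Ideal A :=
  solidIdeal {x | ∀ s ∈ S, |x| ⊓ |s| = 0}
    (fun s _ => by simp)
    (fun a ha b hb s hs => by
      refine le_antisymm ?_ (le_inf (abs_nonneg _) (abs_nonneg _))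
      calc |a + b| ⊓ |s| ≤ (|a| + |b|) ⊓ |s| := inf_le_inf_right _ (abs_add_le a b)
        _ ≤ |a| ⊓ |s| + |b| ⊓ |s| := add_inf_le (abs_nonneg _) (abs_nonneg _) (abs_nonneg _)
        _ = 0 := by rw [ha s hs, hb s hs, add_zero])
    (fun a b h hb s hs =>
      le_antisymm ((inf_le_inf_right _ h).trans (hb s hs).le) (le_inf (abs_nonneg _) (abs_nonneg _)))

theorem mem_polar {S : Set A} {x : A} : x ∈ polar S ↔ ∀ s ∈ S, |x| ⊓ |s| = 0 := Iff.rfl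

theorem isLIdeal_polar (S : Set A) : IsLIdeal (polar S) := isLIdeal_solidIdeal _ _ _ _

theorem isLIdeal_sup {I J : Ideal A} (hI : IsLIdeal I) (hJ : IsLIdeal J) : IsLIdeal (I ⊔ J) := by
  refine ⟨fun a b h hb => ?_⟩
  obtain ⟨i, hi, j, hj, rfl⟩ := Submodule.mem_sup.1 hb
  have h' : |a| ≤ |i| + |j| := h.trans (abs_add_le i j)
  have h1 : a ≤ |i| + |j| := (le_abs_self a).trans h'
  have h2 : -a ≤ |i| + |j| := (neg_le_abs a).trans h'
  set c := (a ⊓ |i|) ⊔ -|i| with hc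
  have hci : |c| ≤ |i| := by
    refine sup_le (sup_le inf_le_right ?_) ?_
    · exact (neg_nonpos.2 (abs_nonneg i)).trans (abs_nonneg i)
    · exact neg_le.1 le_sup_right
  have hcj : |a - c| ≤ |j| := by
    refine sup_le ?_ ?_
    · rw [sub_le_comm]
      refine le_trans (le_inf ?_ ?_) le_sup_left
      · exact sub_le_self _ (abs_nonneg j)
      · rwa [sub_le_iff_le_add]
    · rw [neg_sub, sub_le_iff_le_add']
      refine sup_le (inf_le_left.trans (le_add_of_nonneg_right (abs_nonneg j))) ?_
      rw [neg_le, neg_add, ← sub_eq_add_neg, sub_le_iff_le_add]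
      exact h2
  have : a = c + (a - c) := by ring
  rw [this]
  exact Submodule.add_mem_sup (hI.solid _ _ hci hi) (hJ.solid _ _ hcj hj)

theorem IsMaxLIdeal.one_notMem {M : Ideal A} (hM : IsMaxLIdeal M) : (1 : A) ∉ M :=
  fun h => hM.prop.2 ((Ideal.eq_top_iff_one M).2 h)

theorem IsMaxLIdeal.algebraMap_notMem {M : Ideal A} (hM : IsMaxLIdeal M) {r : ℝ} (hr : r ≠ 0) :
    algebraMap ℝ A r ∉ M := by
  intro h
  apply hM.one_notMem
  have := M.mul_mem_left (algebraMap ℝ A r⁻¹) h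
  rwa [← map_mul, inv_mul_cancel₀ hr, map_one] at this

theorem IsMaxLIdeal.le_or_le {M : Ideal A} (hM : IsMaxLIdeal M) {I J : Ideal A}
    (hI : IsLIdeal I) (hJ : IsLIdeal J) (h : I ⊓ J ≤ M) : I ≤ M ∨ J ≤ M := by
  by_contra! hc
  have key : ∀ K : Ideal A, IsLIdeal K → ¬ K ≤ M → ∃ k ∈ K, ∃ m ∈ M, k + m = 1 := by
    intro K hK hKM
    by_contra hne
    have hle := hM.le_of_ge (y := K ⊔ M)
      ⟨isLIdeal_sup hK hM.prop.1, fun ht => hne ?_⟩ le_sup_right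
    · exact hKM (le_sup_left.trans hle)
    · exact Submodule.mem_sup.1 ((Ideal.eq_top_iff_one _).1 ht)
  obtain ⟨i, hi, m, hm, h1⟩ := key I hI hc.1
  obtain ⟨j, hj, m', hm', h2⟩ := key J hJ hc.2
  apply hM.one_notMem
  have : (1 : A) = i * j + (m * (j + m') + i * m') := by
    calc (1 : A) = (i + m) * (j + m') := by rw [h1, h2, one_mul]
      _ = _ := by ring
  rw [this]
  refine M.add_mem (h ⟨I.mul_mem_right _ hi, J.mul_mem_left _ hj⟩)
    (M.add_mem (M.mul_mem_right _ hm) (M.mul_mem_left _ hm'))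

theorem IsMaxLIdeal.mem_or_mem {M : Ideal A} (hM : IsMaxLIdeal M) {a b : A}
    (h : |a| ⊓ |b| = 0) : a ∈ M ∨ b ∈ M := by
  have hle : polar {a} ⊓ polar (polar {a} : Set A) ≤ M := by
    rintro x ⟨hx1, hx2⟩
    have : |x| ⊓ |x| = 0 := mem_polar.1 hx2 x hx1
    rw [inf_idem] at this
    have hx : x = 0 := by
      refine le_antisymm (this ▸ le_abs_self x) ?_
      have := neg_le_abs x
      rwa [‹|x| = 0›, neg_nonpos] at this
    rw [hx]; exact M.zero_mem
  rcases hM.le_or_le (isLIdeal_polar _) (isLIdeal_polar _) hle with h1 | h1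
  · refine Or.inr (h1 (mem_polar.2 ?_))
    rintro s rfl
    rwa [inf_comm]
  · refine Or.inl (h1 (mem_polar.2 fun s hs => ?_))
    rw [inf_comm]
    exact mem_polar.1 hs a rfl

theorem Yosida.zeroSet_union {I J : Ideal A} (hI : IsLIdeal I) (hJ : IsLIdeal J) :
    Yosida.zeroSet I ∪ Yosida.zeroSet J = Yosida.zeroSet (I ⊓ J) := by
  ext M
  constructor
  · rintro (h | h)
    · exact (inf_le_left : I ⊓ J ≤ I).trans h
    · exact (inf_le_right : I ⊓ J ≤ J).trans h
  · exact fun h => M.2.le_or_le hI hJ h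

theorem isLIdeal_inf {I J : Ideal A} (hI : IsLIdeal I) (hJ : IsLIdeal J) : IsLIdeal (I ⊓ J) :=
  ⟨fun a b h hb => ⟨hI.solid a b h hb.1, hJ.solid a b h hb.2⟩⟩

theorem isLIdeal_sInf {S : Set (Ideal A)} (h : ∀ I ∈ S, IsLIdeal I) : IsLIdeal (sInf S) :=
  ⟨fun a b hab hb => by
    rw [Submodule.mem_sInf] at hb ⊢
    exact fun I hI => (h I hI).solid a b hab (hb I hI)⟩

/-- The topology of the Yosida space: the closed sets are exactly the sets `Z(I)` for l-ideals
`I`. -/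
instance Yosida.instTopologicalSpace : TopologicalSpace (Yosida A) :=
  TopologicalSpace.ofClosed {Z | ∃ I : Ideal A, IsLIdeal I ∧ Z = Yosida.zeroSet I}
    ⟨⊤, ⟨fun _ _ _ _ => trivial⟩, by
      ext M
      simp only [Set.mem_empty_iff_false, false_iff]
      exact fun h => M.2.prop.2 (top_le_iff.1 h)⟩
    (by
      intro S hS
      refine ⟨sInf {I | IsLIdeal I ∧ ∀ J, IsLIdeal J → Yosida.zeroSet J ∈ S → J ≤ I},
        isLIdeal_sInf fun I hI => hI.1, ?_⟩
      ext M
      constructor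
      · intro hM
        have hM' : M.1 ∈ {I : Ideal A | IsLIdeal I ∧
            ∀ J, IsLIdeal J → Yosida.zeroSet J ∈ S → J ≤ I} :=
          ⟨M.2.prop.1, fun J _ hJS => hM _ hJS⟩
        exact sInf_le hM'
      · intro hM Z hZ
        obtain ⟨J, hJ, rfl⟩ := hS hZ
        exact (le_sInf fun I hI => hI.2 J hJ hZ : J ≤ _).trans hM)
    (by
      rintro _ ⟨I, hI, rfl⟩ _ ⟨J, hJ, rfl⟩
      exact ⟨I ⊓ J, isLIdeal_inf hI hJ, Yosida.zeroSet_union hI hJ⟩)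

theorem Yosida.isClosed_iff {Z : Set (Yosida A)} :
    IsClosed Z ↔ ∃ I : Ideal A, IsLIdeal I ∧ Z = Yosida.zeroSet I := by
  rw [← isOpen_compl_iff]
  change Zᶜᶜ ∈ {Z | ∃ I : Ideal A, IsLIdeal I ∧ Z = Yosida.zeroSet I} ↔ _
  rw [compl_compl]
  rfl

/-- Every proper l-ideal is contained in a maximal l-ideal. -/
theorem exists_le_isMaxLIdeal {I : Ideal A} (hI : IsLIdeal I) (hI1 : (1 : A) ∉ I) :
    ∃ M : Ideal A, I ≤ M ∧ IsMaxLIdeal M := by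
  refine zorn_le_nonempty₀ {J : Ideal A | IsLIdeal J ∧ J ≠ ⊤} ?_ I
    ⟨hI, fun h => hI1 (h ▸ trivial)⟩
  intro c hc hchain y hy
  have hdir : DirectedOn (· ≤ ·) c := hchain.directedOn
  refine ⟨sSup c, ⟨⟨fun a b hab hb => ?_⟩, fun h => ?_⟩, fun z hz => le_sSup hz⟩
  · obtain ⟨J, hJ, hbJ⟩ := (Submodule.mem_sSup_of_directed ⟨y, hy⟩ hdir).1 hb
    exact (Submodule.mem_sSup_of_directed ⟨y, hy⟩ hdir).2 ⟨J, hJ, (hc hJ).1.solid a b hab hbJ⟩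
  · have h1 : (1 : A) ∈ sSup c := h ▸ trivial
    obtain ⟨J, hJ, hbJ⟩ := (Submodule.mem_sSup_of_directed ⟨y, hy⟩ hdir).1 h1
    exact (hc hJ).2 ((Ideal.eq_top_iff_one J).2 hbJ)

instance Yosida.instCompactSpace : CompactSpace (Yosida A) := by
  refine ⟨isCompact_of_finite_subfamily_closed fun {ι} t ht hempty => ?_⟩
  by_contra! hne
  classical
  choose I hI hZ using fun i => Yosida.isClosed_iff.1 (ht i)
  let K : Ideal A := solidIdeal
    {x | ∃ s : Finset ι, ∀ M : Yosida A, (∀ i ∈ s, I i ≤ M.1) → x ∈ M.1}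
    ⟨∅, fun M _ => M.1.zero_mem⟩
    (fun a ⟨s, hs⟩ b ⟨s', hs'⟩ => ⟨s ∪ s', fun M hM => M.1.add_mem
      (hs M fun i hi => hM i (Finset.mem_union_left _ hi))
      (hs' M fun i hi => hM i (Finset.mem_union_right _ hi))⟩)
    (fun a b hab ⟨s, hs⟩ => ⟨s, fun M hM => M.2.prop.1.solid a b hab (hs M hM)⟩)
  have hK : IsLIdeal K := isLIdeal_solidIdeal _ _ _ _
  have hK1 : (1 : A) ∉ K := by
    rintro ⟨s, hs⟩
    obtain ⟨M, -, hM⟩ := hne s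
    refine M.2.one_notMem (hs M fun i hi => ?_)
    have := Set.mem_iInter₂.1 hM i hi
    rw [hZ i] at this
    exact this
  obtain ⟨M, hKM, hM⟩ := exists_le_isMaxLIdeal hK hK1
  have : (⟨M, hM⟩ : Yosida A) ∈ Set.univ ∩ ⋂ i, t i := by
    refine ⟨trivial, Set.mem_iInter.2 fun i => ?_⟩
    rw [hZ i]
    intro x hx
    exact hKM ⟨{i}, fun N hN => hN i (Finset.mem_singleton_self i) hx⟩
  rw [hempty] at this
  exact this

/-- If `M` is a maximal l-ideal, then `A / M` is `ℝ`. -/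
theorem existsUnique_residue (M : Yosida A) (a : A) :
    ∃! r : ℝ, a - algebraMap ℝ A r ∈ M.1 := by
  have hM := M.2
  have hL := hM.prop.1
  have pos_nonneg : ∀ x : A, 0 ≤ x ⊔ 0 := fun x => le_sup_right
  -- the closure of `M` is `M`
  have hcl : ∀ x : A, (∀ ε : ℝ, 0 < ε → (|x| - algebraMap ℝ A ε) ⊔ 0 ∈ M.1) → x ∈ M.1 := by
    let N : Ideal A := solidIdeal {x | ∀ ε : ℝ, 0 < ε → (|x| - algebraMap ℝ A ε) ⊔ 0 ∈ M.1}
      (fun ε hε => by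
        have : (|(0 : A)| - algebraMap ℝ A ε) ⊔ 0 = 0 := by
          rw [abs_zero, zero_sub]
          exact sup_eq_right.2 (neg_nonpos.2 (algebraMap_nonneg hε.le))
        rw [this]; exact M.1.zero_mem)
      (fun a ha b hb ε hε => by
        refine LIdeal.mem_of_le hL (pos_nonneg _) ?_
          (M.1.add_mem (ha (ε / 2) (half_pos hε)) (hb (ε / 2) (half_pos hε)))
        refine sup_le ?_ (add_nonneg (pos_nonneg _) (pos_nonneg _))
        refine le_trans ?_ (add_le_add le_sup_left le_sup_left)
        have : algebraMap ℝ A ε = algebraMap ℝ A (ε / 2) + algebraMap ℝ A (ε / 2) := by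
          rw [← map_add, add_halves]
        rw [this, sub_add_sub_comm]
        exact sub_le_sub_right (abs_add_le a b) _)
      (fun a b hab hb ε hε => LIdeal.mem_of_le hL (pos_nonneg _)
        (sup_le_sup_right (sub_le_sub_right hab _) _) (hb ε hε))
    have hN : IsLIdeal N := isLIdeal_solidIdeal _ _ _ _
    have hMN : M.1 ≤ N := fun x hx ε hε => LIdeal.mem_of_le hL (pos_nonneg _)
      (sup_le (sub_le_self _ (algebraMap_nonneg hε.le)) (abs_nonneg x)) ((LIdeal.abs_mem hL).2 hx)
    have hN1 : N ≠ ⊤ := by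
      intro h
      have h1 : (1 : A) ∈ N := h ▸ trivial
      have h2 := h1 (1 / 2) (by norm_num)
      have h3 : (|(1 : A)| - algebraMap ℝ A (1 / 2)) ⊔ 0 = algebraMap ℝ A (1 / 2) := by
        rw [abs_of_nonneg (zero_le_one : (0 : A) ≤ 1), ← map_one (algebraMap ℝ A), ← map_sub,
          show (1 : ℝ) - 1 / 2 = 1 / 2 by norm_num]
        exact sup_eq_left.2 (algebraMap_nonneg (by norm_num))
      rw [h3] at h2
      exact hM.algebraMap_notMem (by norm_num) h2
    exact fun x hx => hM.le_of_ge ⟨hN, hN1⟩ hMN hx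
  refine existsUnique_of_exists_of_unique ?_ ?_
  · obtain ⟨n, hn0, hn⟩ := abs_bounded a
    let S : Set ℝ := {s | (a - algebraMap ℝ A s) ⊔ 0 ∈ M.1}
    have hup : ∀ s ∈ S, ∀ t, s ≤ t → t ∈ S := fun s hs t hst =>
      LIdeal.mem_of_le hL (pos_nonneg _)
        (sup_le_sup_right (sub_le_sub_left (algebraMap_mono hst) _) _) hs
    have hne : S.Nonempty := ⟨n, by
      change (a - algebraMap ℝ A n) ⊔ 0 ∈ M.1
      rw [sup_eq_right.2 (sub_nonpos.2 ((le_abs_self a).trans hn))]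
      exact M.1.zero_mem⟩
    have hbdd : BddBelow S := by
      refine ⟨-n, fun s hs => ?_⟩
      by_contra! hlt
      refine hM.algebraMap_notMem (r := -n - s) (by linarith) ?_
      refine LIdeal.mem_of_le hL (algebraMap_nonneg (by linarith)) (le_trans ?_ le_sup_left) hs
      rw [map_sub, map_neg]
      exact sub_le_sub_right (neg_le.1 ((neg_le_abs a).trans hn)) _
    refine ⟨sInf S, hcl _ fun ε hε => ?_⟩
    have h1 : (a - algebraMap ℝ A (sInf S + ε)) ⊔ 0 ∈ M.1 := by
      obtain ⟨s, hs, hlt⟩ := Real.lt_sInf_add_pos hne hε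
      exact hup s hs _ hlt.le
    have h2 : (algebraMap ℝ A (sInf S - ε) - a) ⊔ 0 ∈ M.1 := by
      have hnot : sInf S - ε ∉ S := fun h => by
        have := csInf_le hbdd h
        linarith
      set b := a - algebraMap ℝ A (sInf S - ε) with hb
      have hdis : |b ⊔ 0| ⊓ |-b ⊔ 0| = 0 := by
        rw [abs_of_nonneg (pos_nonneg _), abs_of_nonneg (pos_nonneg _)]
        exact posPart_inf_negPart_eq_zero b
      have := (hM.mem_or_mem hdis).resolve_left hnot
      rwa [hb, neg_sub] at this
    refine LIdeal.mem_of_le hL (pos_nonneg _) ?_ (M.1.add_mem h1 h2)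
    refine sup_le ?_ (add_nonneg (pos_nonneg _) (pos_nonneg _))
    rw [sub_le_iff_le_add]
    refine sup_le ?_ ?_
    · rw [← sub_le_iff_le_add]
      refine le_trans ?_ (le_add_of_nonneg_right (pos_nonneg _))
      refine le_trans (le_of_eq ?_) le_sup_left
      rw [map_add]; ring
    · rw [← sub_le_iff_le_add]
      refine le_trans ?_ (le_add_of_nonneg_left (pos_nonneg _))
      refine le_trans (le_of_eq ?_) le_sup_left
      rw [map_sub]; ring
  · intro r s hr hs
    by_contra hne
    refine hM.algebraMap_notMem (sub_ne_zero.2 hne) ?_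
    have := M.1.sub_mem hs hr
    rw [map_sub]
    convert this using 1
    ring

/-- The map `ζ_A`: `ζ_A(a)(M)` is the unique real number `r` with `a + M = r + M`. -/
def zeta (a : A) (M : Yosida A) : ℝ := (existsUnique_residue M a).choose

theorem zeta_spec (a : A) (M : Yosida A) : a - algebraMap ℝ A (zeta a M) ∈ M.1 :=
  (existsUnique_residue M a).choose_spec.1

theorem isMaxLIdeal_of_residue {I : Ideal A} (hI : IsLIdeal I) (h1 : (1 : A) ∉ I)
    (h : ∀ a : A, ∃ r : ℝ, a - algebraMap ℝ A r ∈ I) : IsMaxLIdeal I := by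
  refine ⟨⟨hI, fun ht => h1 (ht ▸ trivial)⟩, fun J hJ hIJ a ha => ?_⟩
  obtain ⟨r, hr⟩ := h a
  have hrJ : algebraMap ℝ A r ∈ J := by
    have := J.sub_mem ha (hIJ hr)
    rwa [sub_sub_cancel] at this
  by_cases hr0 : r = 0
  · simpa [hr0] using hr
  · refine absurd ((Ideal.eq_top_iff_one J).2 ?_) hJ.2
    have := J.mul_mem_left (algebraMap ℝ A r⁻¹) hrJ
    rwa [← map_mul, inv_mul_cancel₀ hr0, map_one] at this

variable {B : Type*} [CommRing B] [Lattice B] [Algebra ℝ B] [IsBal B]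

/-- The map `Y(α) = α⁻¹ : Y_B → Y_A` induced by a morphism `α : A → B`. -/
def Yosida.map (α : BalHom A B) (M : Yosida B) : Yosida A :=
  ⟨M.1.comap α.toAlgHom, isMaxLIdeal_of_residue
    ⟨fun a b hab hb => by
      have habs : ∀ x : A, α |x| = |α x| := fun x => by
        have := α.map_sup' x (-x)
        have hn : α (-x) = -α x := map_neg α.toAlgHom x
        exact this.trans (congrArg (α x ⊔ ·) hn)
      have hmono : ∀ x y : A, x ≤ y → α x ≤ α y := fun x y hxy => by
        have := α.map_sup' x y
        rw [sup_eq_right.2 hxy] at this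
        exact sup_eq_right.1 this.symm
      refine M.2.prop.1.solid (α a) (α b) ?_ hb
      rw [← habs, ← habs]
      exact hmono _ _ hab⟩
    (fun h => M.2.one_notMem (by simpa [Ideal.mem_comap] using h))
    (fun a => ⟨zeta (α a) M, by
      have := zeta_spec (α a) M
      rw [Ideal.mem_comap, map_sub, AlgHom.commutes]
      exact this⟩)⟩

end Yosida

/-! ### The algebras `C(X)` -/

instance instIsBalContinuousMap (X : Type*) [TopologicalSpace X] [CompactSpace X] :
    IsBal C(X, ℝ) where
  add_le_add_left a b h c := fun x => add_le_add_left (h x) (c x)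
  zero_le_one := fun _ => zero_le_one
  mul_le_mul_of_nonneg_left a ha b c h := fun x => mul_le_mul_of_nonneg_left (h x) (ha x)
  mul_le_mul_of_nonneg_right a ha b c h := fun x => mul_le_mul_of_nonneg_right (h x) (ha x)
  smul_nonneg' r a hr ha := fun x => mul_nonneg hr (ha x)
  bounded' a := by
    obtain ⟨n, hn⟩ := exists_nat_ge ‖a‖
    refine ⟨n, fun x => ?_⟩
    have : a x ≤ n := (le_abs_self _).trans ((a.norm_coe_le_norm x).trans hn)
    simpa using this
  archimedean' a b h := fun x => by
    by_contra! hx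
    change 0 < a x at hx
    obtain ⟨n, hn⟩ := exists_nat_gt (b x / a x)
    have h1 : (n : ℝ) * a x ≤ b x := by simpa using h n x
    rw [div_lt_iff₀ hx] at hn
    linarith

/-- The map `ε_X : X → Y_{C(X)}`, `ε_X(x) = {f ∈ C(X) | f(x) = 0}`. -/
def Yosida.point {X : Type*} [TopologicalSpace X] [CompactSpace X] (x : X) : Yosida C(X, ℝ) :=
  ⟨{ carrier := {f | f x = 0}
     zero_mem' := rfl
     add_mem' := fun {f g} hf hg => by
      have h1 : f x = 0 := hf
      have h2 : g x = 0 := hg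
      change (f + g) x = 0
      simp [h1, h2]
     smul_mem' := fun c f hf => by
      have h1 : f x = 0 := hf
      change (c * f) x = 0
      simp [h1] },
    isMaxLIdeal_of_residue
      ⟨fun f g h hg => by
        have h1 : g x = 0 := hg
        have h2 : |f| x ≤ |g| x := h x
        have h3 : |f x| ≤ |g x| := by simpa [ContinuousMap.abs_apply] using h2
        rw [h1, abs_zero] at h3
        exact abs_nonpos_iff.1 h3⟩
      (fun h => one_ne_zero (α := ℝ) h)
      (fun f => ⟨f x, by
        change (f - algebraMap ℝ C(X, ℝ) (f x)) x = 0
        simp⟩)⟩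

/-! ### Quotients by l-ideals -/

section Quotient

variable {A : Type*} [CommRing A] [Lattice A] [IsOrderedRing A]

/-- The join induced on the quotient of an l-ring by an l-ideal. -/
def quotientSup (I : Ideal A) [IsLIdeal I] (x y : A ⧸ I) : A ⧸ I :=
  Quotient.liftOn₂' x y (fun a b => Ideal.Quotient.mk I (a ⊔ b)) (by
    intro a b a' b' ha hb
    have ha := (Submodule.quotientRel_def _).1 ha
    have hb := (Submodule.quotientRel_def _).1 hb
    rw [Ideal.Quotient.eq]
    have h1 : a ⊔ b - a' ⊔ b ∈ I := IsLIdeal.solid _ _ (abs_sup_sub_sup_le_abs a a' b) ha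
    have h2 : b ⊔ a' - b' ⊔ a' ∈ I := IsLIdeal.solid _ _ (abs_sup_sub_sup_le_abs b b' a') hb
    have := I.add_mem h1 h2
    rwa [sup_comm b a', sup_comm b' a', sub_add_sub_cancel] at this)

/-- The meet induced on the quotient of an l-ring by an l-ideal. -/
def quotientInf (I : Ideal A) [IsLIdeal I] (x y : A ⧸ I) : A ⧸ I :=
  Quotient.liftOn₂' x y (fun a b => Ideal.Quotient.mk I (a ⊓ b)) (by
    intro a b a' b' ha hb
    have ha := (Submodule.quotientRel_def _).1 ha
    have hb := (Submodule.quotientRel_def _).1 hb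
    rw [Ideal.Quotient.eq]
    have h1 : a ⊓ b - a' ⊓ b ∈ I := IsLIdeal.solid _ _ (abs_inf_sub_inf_le_abs a a' b) ha
    have h2 : b ⊓ a' - b' ⊓ a' ∈ I := IsLIdeal.solid _ _ (abs_inf_sub_inf_le_abs b b' a') hb
    have := I.add_mem h1 h2
    rwa [inf_comm b a', inf_comm b' a', sub_add_sub_cancel] at this)

/-- The quotient of an l-ring by an l-ideal, with the lattice operations induced from those of the
l-ring; the order is `x ≤ y ↔ x ⊔ y = y`. -/
instance instLatticeQuotient (I : Ideal A) [IsLIdeal I] : Lattice (A ⧸ I) :=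
  @Lattice.mk' _ ⟨quotientSup I⟩ ⟨quotientInf I⟩
    (by rintro ⟨a⟩ ⟨b⟩; exact congrArg (Ideal.Quotient.mk I) (sup_comm a b))
    (by rintro ⟨a⟩ ⟨b⟩ ⟨c⟩; exact congrArg (Ideal.Quotient.mk I) (sup_assoc a b c))
    (by rintro ⟨a⟩ ⟨b⟩; exact congrArg (Ideal.Quotient.mk I) (inf_comm a b))
    (by rintro ⟨a⟩ ⟨b⟩ ⟨c⟩; exact congrArg (Ideal.Quotient.mk I) (inf_assoc a b c))
    (by rintro ⟨a⟩ ⟨b⟩; exact congrArg (Ideal.Quotient.mk I) (sup_inf_self (a := a) (b := b)))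
    (by rintro ⟨a⟩ ⟨b⟩; exact congrArg (Ideal.Quotient.mk I) (inf_sup_self (a := a) (b := b)))

theorem mk_sup (I : Ideal A) [IsLIdeal I] (a b : A) :
    Ideal.Quotient.mk I (a ⊔ b) = Ideal.Quotient.mk I a ⊔ Ideal.Quotient.mk I b := rfl

theorem mk_inf (I : Ideal A) [IsLIdeal I] (a b : A) :
    Ideal.Quotient.mk I (a ⊓ b) = Ideal.Quotient.mk I a ⊓ Ideal.Quotient.mk I b := rfl

theorem mk_le_mk_iff (I : Ideal A) [IsLIdeal I] {a b : A} :
    Ideal.Quotient.mk I a ≤ Ideal.Quotient.mk I b ↔ (a - b) ⊔ 0 ∈ I := by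
  rw [← sup_eq_right, ← mk_sup, Ideal.Quotient.eq, sup_sub, sub_self]

theorem mk_mono (I : Ideal A) [IsLIdeal I] {a b : A} (h : a ≤ b) :
    Ideal.Quotient.mk I a ≤ Ideal.Quotient.mk I b := by
  rw [← sup_eq_right, ← mk_sup, sup_eq_right.2 h]

theorem exists_nonneg_rep (I : Ideal A) [IsLIdeal I] {x : A ⧸ I} (h : 0 ≤ x) :
    ∃ a : A, 0 ≤ a ∧ Ideal.Quotient.mk I a = x := by
  obtain ⟨a, rfl⟩ := Ideal.Quotient.mk_surjective x
  refine ⟨a ⊔ 0, le_sup_right, ?_⟩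
  rw [mk_sup, map_zero]
  exact sup_eq_left.2 h

instance instIsOrderedRingQuotient (I : Ideal A) [IsLIdeal I] : IsOrderedRing (A ⧸ I) := by
  have hadd : ∀ x y : A ⧸ I, x ≤ y → ∀ z, x + z ≤ y + z := by
    intro x y h z
    obtain ⟨a, rfl⟩ := Ideal.Quotient.mk_surjective x
    obtain ⟨b, rfl⟩ := Ideal.Quotient.mk_surjective y
    obtain ⟨c, rfl⟩ := Ideal.Quotient.mk_surjective z
    rw [← map_add, ← map_add, mk_le_mk_iff, add_sub_add_right_eq_sub]
    exact (mk_le_mk_iff I).1 h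
  haveI : IsOrderedAddMonoid (A ⧸ I) := ⟨fun x y h z => hadd x y h z, fun x y h z => by
    rw [add_comm z x, add_comm z y]; exact hadd x y h z⟩
  haveI : ZeroLEOneClass (A ⧸ I) := ⟨by
    rw [← map_zero (Ideal.Quotient.mk I), ← map_one (Ideal.Quotient.mk I)]
    exact mk_mono I zero_le_one⟩
  refine IsOrderedRing.of_mul_nonneg fun x y hx hy => ?_
  obtain ⟨a, ha, rfl⟩ := exists_nonneg_rep I hx
  obtain ⟨b, hb, rfl⟩ := exists_nonneg_rep I hy
  rw [← map_mul, ← map_zero (Ideal.Quotient.mk I)]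
  exact mk_mono I (mul_nonneg ha hb)

/-- An archimedean l-ideal: an l-ideal `I` such that `A / I` is archimedean. -/
def IsArchLIdeal (I : Ideal A) : Prop :=
  ∃ _ : IsLIdeal I, ∀ x y : A ⧸ I, (∀ n : ℕ, n • x ≤ y) → x ≤ 0

/-- The archimedean l-ideal generated by a set `S`: the least archimedean l-ideal that contains
`S`. -/
def archSpan (S : Set A) : Ideal A :=
  sInf {I : Ideal A | IsArchLIdeal I ∧ S ⊆ I}

instance isLIdeal_archSpan (S : Set A) : IsLIdeal (archSpan S) :=
  ⟨fun a b hab hb => by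
    rw [archSpan, Submodule.mem_sInf] at hb ⊢
    exact fun I hI => hI.1.1.solid a b hab (hb I hI)⟩

theorem subset_archSpan (S : Set A) : S ⊆ archSpan S := fun _ hs =>
  (Submodule.mem_sInf).2 fun _ hI => hI.2 hs

theorem isArchLIdeal_archSpan (S : Set A) : IsArchLIdeal (archSpan S) := by
  refine ⟨inferInstance, fun x y h => ?_⟩
  obtain ⟨a, rfl⟩ := Ideal.Quotient.mk_surjective x
  obtain ⟨b, rfl⟩ := Ideal.Quotient.mk_surjective y
  rw [← map_zero (Ideal.Quotient.mk (archSpan S)), mk_le_mk_iff]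
  refine (Submodule.mem_sInf).2 fun I hI => ?_
  obtain ⟨⟨hL, hA⟩, hS⟩ := hI
  rw [← mk_le_mk_iff, map_zero]
  refine hA _ (Ideal.Quotient.mk I b) fun n => ?_
  have := h n
  rw [← map_nsmul, mk_le_mk_iff] at this
  rw [← map_nsmul, mk_le_mk_iff]
  exact (Submodule.mem_sInf).1 this I ⟨⟨hL, hA⟩, hS⟩

theorem archSpan_le {S : Set A} {I : Ideal A} (hI : IsArchLIdeal I) (h : S ⊆ I) :
    archSpan S ≤ I := sInf_le ⟨hI, h⟩

end Quotient

instance instIsBalQuotient {A : Type*} [CommRing A] [Lattice A] [Algebra ℝ A] [IsBal A]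
    (S : Set A) : IsBal (A ⧸ archSpan S) where
  smul_nonneg' r x hr hx := by
    obtain ⟨a, ha, rfl⟩ := exists_nonneg_rep _ hx
    have := mk_mono (archSpan S) (IsBal.smul_nonneg' r a hr ha)
    rwa [map_zero] at this
  bounded' x := by
    obtain ⟨a, rfl⟩ := Ideal.Quotient.mk_surjective x
    obtain ⟨n, hn⟩ := IsBal.bounded' a
    refine ⟨n, ?_⟩
    have := mk_mono (archSpan S) hn
    rwa [map_nsmul, map_one] at this
  archimedean' := (isArchLIdeal_archSpan S).2

/-! ### Free objects over weighted sets -/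

/-- Terms in the signature of unital l-algebras, with variables in `X`. -/
inductive Term (X : Type u) : Type u
  | var : X → Term X
  | const : ℝ → Term X
  | add : Term X → Term X → Term X
  | mul : Term X → Term X → Term X
  | neg : Term X → Term X
  | sup : Term X → Term X → Term X
  | inf : Term X → Term X → Term X

/-- The value of a term under an assignment of the variables. -/
def Term.eval {X : Type u} {B : Type v} [CommRing B] [Lattice B] [Algebra ℝ B] (φ : X → B) :
    Term X → B
  | var x => φ x
  | const r => algebraMap ℝ B r
  | add s t => s.eval φ + t.eval φ
  | mul s t => s.eval φ * t.eval φ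
  | neg s => -s.eval φ
  | sup s t => s.eval φ ⊔ t.eval φ
  | inf s t => s.eval φ ⊓ t.eval φ

/-- A morphism of weighted sets from `(X, w)` to `(B, ‖·‖)`. -/
def IsWeighted {X : Type u} (w : X → ℝ≥0) {B : Type v} [CommRing B] [Lattice B] [Algebra ℝ B]
    (φ : X → B) : Prop :=
  ∀ x, balNorm (φ x) ≤ w x

/-- Two terms are identified if they have the same value under every weighted set morphism into a
bounded archimedean l-algebra. -/
def termSetoid {X : Type u} (w : X → ℝ≥0) : Setoid (Term X) where
  r s t := ∀ (B : Type u) [CommRing B] [Lattice B] [Algebra ℝ B] [IsBal B] (φ : X → B),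
    IsWeighted w φ → s.eval φ = t.eval φ
  iseqv := ⟨fun _ _ _ _ _ _ _ _ => rfl, fun h B _ _ _ _ φ hφ => (h B φ hφ).symm,
    fun h h' B _ _ _ _ φ hφ => (h B φ hφ).trans (h' B φ hφ)⟩

/-- The free bounded archimedean l-algebra over the weighted set `(X, w)`, constructed from terms.
Its universal property is `FreeBal.existsUnique_lift` below. -/
def FreeBal {X : Type u} (w : X → ℝ≥0) : Type u := Quotient (termSetoid w)

namespace FreeBal

variable {X : Type u} {w : X → ℝ≥0}

/-- The class of a term. -/
def mk (w : X → ℝ≥0) (t : Term X) : FreeBal w := Quotient.mk (termSetoid w) t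

/-- The canonical map from `X` to the free algebra. -/
def of (w : X → ℝ≥0) (x : X) : FreeBal w := mk w (.var x)

theorem mk_surjective (x : FreeBal w) : ∃ t, mk w t = x := Quotient.exists_rep x

theorem sound {s t : Term X}
    (h : ∀ (B : Type u) [CommRing B] [Lattice B] [Algebra ℝ B] [IsBal B] (φ : X → B),
      IsWeighted w φ → s.eval φ = t.eval φ) : mk w s = mk w t :=
  Quotient.sound (s := termSetoid w) h

theorem exact {s t : Term X} (h : mk w s = mk w t) {B : Type u} [CommRing B] [Lattice B]
    [Algebra ℝ B] [IsBal B] {φ : X → B} (hφ : IsWeighted w φ) : s.eval φ = t.eval φ :=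
  (Quotient.exact (s := termSetoid w) h : (termSetoid w).r s t) B φ hφ

instance : Zero (FreeBal w) := ⟨mk w (.const 0)⟩
instance : One (FreeBal w) := ⟨mk w (.const 1)⟩
instance : Add (FreeBal w) := ⟨Quotient.map₂ .add fun _ _ h _ _ h' B _ _ _ _ φ hφ =>
  congrArg₂ (· + ·) (h B φ hφ) (h' B φ hφ)⟩
instance : Mul (FreeBal w) := ⟨Quotient.map₂ .mul fun _ _ h _ _ h' B _ _ _ _ φ hφ =>
  congrArg₂ (· * ·) (h B φ hφ) (h' B φ hφ)⟩
instance : Neg (FreeBal w) := ⟨Quotient.map .neg fun _ _ h B _ _ _ _ φ hφ =>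
  congrArg (- ·) (h B φ hφ)⟩
/-- The join of the free algebra. -/
def supAux : FreeBal w → FreeBal w → FreeBal w :=
  Quotient.map₂ .sup fun _ _ h _ _ h' B _ _ _ _ φ hφ => congrArg₂ (· ⊔ ·) (h B φ hφ) (h' B φ hφ)
/-- The meet of the free algebra. -/
def infAux : FreeBal w → FreeBal w → FreeBal w :=
  Quotient.map₂ .inf fun _ _ h _ _ h' B _ _ _ _ φ hφ => congrArg₂ (· ⊓ ·) (h B φ hφ) (h' B φ hφ)

theorem mk_add (s t : Term X) : mk w s + mk w t = mk w (.add s t) := rfl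
theorem mk_mul (s t : Term X) : mk w s * mk w t = mk w (.mul s t) := rfl
theorem mk_neg (s : Term X) : -mk w s = mk w (.neg s) := rfl
theorem zero_def : (0 : FreeBal w) = mk w (.const 0) := rfl
theorem one_def : (1 : FreeBal w) = mk w (.const 1) := rfl

instance : CommRing (FreeBal w) where
  add_assoc := by
    rintro ⟨a⟩ ⟨b⟩ ⟨c⟩; exact sound fun B _ _ _ _ φ _ => by simp [Term.eval, add_assoc]
  zero_add := by rintro ⟨a⟩; exact sound fun B _ _ _ _ φ _ => by simp [Term.eval]
  add_zero := by rintro ⟨a⟩; exact sound fun B _ _ _ _ φ _ => by simp [Term.eval]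
  add_comm := by
    rintro ⟨a⟩ ⟨b⟩; exact sound fun B _ _ _ _ φ _ => by simp [Term.eval, add_comm]
  neg_add_cancel := by rintro ⟨a⟩; exact sound fun B _ _ _ _ φ _ => by simp [Term.eval]
  mul_assoc := by
    rintro ⟨a⟩ ⟨b⟩ ⟨c⟩; exact sound fun B _ _ _ _ φ _ => by simp [Term.eval, mul_assoc]
  mul_comm := by
    rintro ⟨a⟩ ⟨b⟩; exact sound fun B _ _ _ _ φ _ => by simp [Term.eval, mul_comm]
  one_mul := by rintro ⟨a⟩; exact sound fun B _ _ _ _ φ _ => by simp [Term.eval]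
  mul_one := by rintro ⟨a⟩; exact sound fun B _ _ _ _ φ _ => by simp [Term.eval]
  zero_mul := by rintro ⟨a⟩; exact sound fun B _ _ _ _ φ _ => by simp [Term.eval]
  mul_zero := by rintro ⟨a⟩; exact sound fun B _ _ _ _ φ _ => by simp [Term.eval]
  left_distrib := by
    rintro ⟨a⟩ ⟨b⟩ ⟨c⟩; exact sound fun B _ _ _ _ φ _ => by simp [Term.eval, mul_add]
  right_distrib := by
    rintro ⟨a⟩ ⟨b⟩ ⟨c⟩; exact sound fun B _ _ _ _ φ _ => by simp [Term.eval, add_mul]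
  nsmul := nsmulRec
  zsmul := zsmulRec

instance : Algebra ℝ (FreeBal w) := RingHom.toAlgebra
  { toFun := fun r => mk w (.const r)
    map_one' := rfl
    map_zero' := rfl
    map_add' := fun r s => sound fun B _ _ _ _ φ _ => by simp [Term.eval]
    map_mul' := fun r s => sound fun B _ _ _ _ φ _ => by simp [Term.eval] }

theorem algebraMap_def (r : ℝ) : algebraMap ℝ (FreeBal w) r = mk w (.const r) := rfl

instance : Lattice (FreeBal w) := @Lattice.mk' _ ⟨supAux⟩ ⟨infAux⟩
  (by rintro ⟨a⟩ ⟨b⟩; exact sound fun B _ _ _ _ φ _ => by simp [Term.eval, sup_comm])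
  (by rintro ⟨a⟩ ⟨b⟩ ⟨c⟩; exact sound fun B _ _ _ _ φ _ => by simp [Term.eval, sup_assoc])
  (by rintro ⟨a⟩ ⟨b⟩; exact sound fun B _ _ _ _ φ _ => by simp [Term.eval, inf_comm])
  (by rintro ⟨a⟩ ⟨b⟩ ⟨c⟩; exact sound fun B _ _ _ _ φ _ => by simp [Term.eval, inf_assoc])
  (by rintro ⟨a⟩ ⟨b⟩; exact sound fun B _ _ _ _ φ _ => by simp [Term.eval])
  (by rintro ⟨a⟩ ⟨b⟩; exact sound fun B _ _ _ _ φ _ => by simp [Term.eval])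

theorem mk_sup (s t : Term X) : mk w s ⊔ mk w t = mk w (.sup s t) := rfl
theorem mk_inf (s t : Term X) : mk w s ⊓ mk w t = mk w (.inf s t) := rfl

theorem mk_le_mk_iff {s t : Term X} : mk w s ≤ mk w t ↔
    ∀ (B : Type u) [CommRing B] [Lattice B] [Algebra ℝ B] [IsBal B] (φ : X → B),
      IsWeighted w φ → s.eval φ ≤ t.eval φ := by
  rw [← sup_eq_right]
  constructor
  · intro h B _ _ _ _ φ hφ
    exact sup_eq_right.1 (exact (s := .sup s t) h hφ)
  · intro h
    exact sound (s := .sup s t) fun B _ _ _ _ φ hφ => sup_eq_right.2 (h B φ hφ)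

theorem mk_nsmul_eval (n : ℕ) (t : Term X) : ∃ t' : Term X, n • mk w t = mk w t' ∧
    ∀ (B : Type u) [CommRing B] [Lattice B] [Algebra ℝ B] [IsBal B] (φ : X → B),
      t'.eval φ = n • t.eval φ := by
  induction n with
  | zero => exact ⟨.const 0, by rw [zero_nsmul, zero_def], fun B _ _ _ _ φ => by simp [Term.eval]⟩
  | succ k ih =>
    obtain ⟨t', h1, h2⟩ := ih
    refine ⟨.add t' t, by rw [succ_nsmul, h1, mk_add], fun B _ _ _ _ φ => ?_⟩
    rw [succ_nsmul, ← h2 B φ]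
    rfl

instance : IsOrderedRing (FreeBal w) := by
  have hadd : ∀ a b : FreeBal w, a ≤ b → ∀ c, a + c ≤ b + c := by
    intro a b h c
    obtain ⟨a, rfl⟩ := mk_surjective a
    obtain ⟨b, rfl⟩ := mk_surjective b
    obtain ⟨c, rfl⟩ := mk_surjective c
    rw [mk_add, mk_add, mk_le_mk_iff]
    rw [mk_le_mk_iff] at h
    intro B _ _ _ _ φ hφ
    exact add_le_add_left (h B φ hφ) _
  haveI : IsOrderedAddMonoid (FreeBal w) := ⟨hadd, fun a b h c => by
    rw [add_comm c a, add_comm c b]; exact hadd a b h c⟩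
  haveI : ZeroLEOneClass (FreeBal w) := ⟨by
    rw [zero_def, one_def, mk_le_mk_iff]
    intro B _ _ _ _ φ hφ
    exact algebraMap_mono zero_le_one⟩
  refine IsOrderedRing.of_mul_nonneg fun a b ha hb => ?_
  obtain ⟨a, rfl⟩ := mk_surjective a
  obtain ⟨b, rfl⟩ := mk_surjective b
  rw [zero_def, mk_le_mk_iff] at ha hb
  rw [zero_def, mk_mul, mk_le_mk_iff]
  intro B _ _ _ _ φ hφ
  have h1 := ha B φ hφ
  have h2 := hb B φ hφ
  simp only [Term.eval, map_zero] at h1 h2 ⊢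
  exact mul_nonneg h1 h2

theorem abs_of_le (x : X) {ε : ℝ} (hε : 0 < ε) :
    |of w x| ≤ algebraMap ℝ (FreeBal w) (w x + ε) := by
  have : |of w x| = mk w (.sup (.var x) (.neg (.var x))) := rfl
  rw [this, algebraMap_def, mk_le_mk_iff]
  intro B _ _ _ _ φ hφ
  exact (abs_le_balNorm_add (φ x) hε).trans (algebraMap_mono (by simpa using hφ x))

theorem exists_abs_le (t : Term X) : ∃ n : ℕ, |mk w t| ≤ n • (1 : FreeBal w) := by
  induction t with
  | var x =>
    obtain ⟨n, hn⟩ := exists_nat_ge ((w x : ℝ) + 1)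
    refine ⟨n, (abs_of_le x one_pos).trans ?_⟩
    have : (n • (1 : FreeBal w)) = algebraMap ℝ _ (n : ℝ) := by simp
    rw [this, algebraMap_def, algebraMap_def, mk_le_mk_iff]
    exact fun B _ _ _ _ φ _ => algebraMap_mono hn
  | const r =>
    obtain ⟨n, hn⟩ := exists_nat_ge |r|
    have h1 : (n • (1 : FreeBal w)) = algebraMap ℝ _ (n : ℝ) := by simp
    refine ⟨n, ?_⟩
    have h2 : |mk w (.const r)| = mk w (.sup (.const r) (.neg (.const r))) := rfl
    rw [h1, h2, algebraMap_def, mk_le_mk_iff]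
    intro B _ _ _ _ φ _
    refine sup_le (algebraMap_mono ((le_abs_self r).trans hn)) ?_
    change -algebraMap ℝ B r ≤ algebraMap ℝ B n
    rw [← map_neg]
    exact algebraMap_mono ((neg_le_abs r).trans hn)
  | add s t hs ht =>
    obtain ⟨n, hn⟩ := hs
    obtain ⟨m, hm⟩ := ht
    refine ⟨n + m, ?_⟩
    rw [← mk_add, add_nsmul]
    exact (abs_add_le _ _).trans (add_le_add hn hm)
  | mul s t hs ht =>
    obtain ⟨n, hn⟩ := hs
    obtain ⟨m, hm⟩ := ht
    refine ⟨n * m, ?_⟩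
    have hmn : (n * m) • (1 : FreeBal w) = (n • (1 : FreeBal w)) * (m • (1 : FreeBal w)) := by
      simp
    have key : |mk w s * mk w t| ≤ |mk w s| * |mk w t| := by
      have h1 : |mk w s * mk w t| =
        mk w (.sup (.mul s t) (.neg (.mul s t))) := rfl
      have h2 : |mk w s| * |mk w t| = mk w (.mul (.sup s (.neg s)) (.sup t (.neg t))) := rfl
      rw [h1, h2, mk_le_mk_iff]
      exact fun B _ _ _ _ φ _ => abs_mul_le (s.eval φ) (t.eval φ)
    rw [hmn, ← mk_mul]
    exact key.trans (mul_le_mul hn hm (abs_nonneg _) ((abs_nonneg _).trans hn))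
  | neg s hs =>
    obtain ⟨n, hn⟩ := hs
    exact ⟨n, by rw [← mk_neg, abs_neg]; exact hn⟩
  | sup s t hs ht =>
    obtain ⟨n, hn⟩ := hs
    obtain ⟨m, hm⟩ := ht
    refine ⟨n + m, ?_⟩
    have h0 : ∀ k : ℕ, 0 ≤ k • (1 : FreeBal w) := fun k => nsmul_nonneg zero_le_one k
    rw [← mk_sup, add_nsmul]
    refine sup_le (sup_le ?_ ?_) ?_
    · exact ((le_abs_self _).trans hn).trans (le_add_of_nonneg_right (h0 m))
    · exact ((le_abs_self _).trans hm).trans (le_add_of_nonneg_left (h0 n))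
    · rw [neg_sup]
      exact inf_le_left.trans (((neg_le_abs _).trans hn).trans (le_add_of_nonneg_right (h0 m)))
  | inf s t hs ht =>
    obtain ⟨n, hn⟩ := hs
    obtain ⟨m, hm⟩ := ht
    refine ⟨n + m, ?_⟩
    have h0 : ∀ k : ℕ, 0 ≤ k • (1 : FreeBal w) := fun k => nsmul_nonneg zero_le_one k
    rw [← mk_inf, add_nsmul]
    refine sup_le ?_ ?_
    · exact inf_le_left.trans (((le_abs_self _).trans hn).trans (le_add_of_nonneg_right (h0 m)))
    · rw [neg_inf]
      refine sup_le ?_ ?_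
      · exact ((neg_le_abs _).trans hn).trans (le_add_of_nonneg_right (h0 m))
      · exact ((neg_le_abs _).trans hm).trans (le_add_of_nonneg_left (h0 n))

instance : IsBal (FreeBal w) where
  smul_nonneg' r a hr ha := by
    obtain ⟨a, rfl⟩ := mk_surjective a
    rw [zero_def, mk_le_mk_iff] at ha
    rw [Algebra.smul_def, algebraMap_def, mk_mul, zero_def, mk_le_mk_iff]
    intro B _ _ _ _ φ hφ
    have h1 := ha B φ hφ
    simp only [Term.eval, map_zero] at h1 ⊢
    exact mul_nonneg (algebraMap_nonneg hr) h1
  bounded' a := by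
    obtain ⟨a, rfl⟩ := mk_surjective a
    obtain ⟨n, hn⟩ := exists_abs_le (w := w) a
    exact ⟨n, (le_abs_self _).trans hn⟩
  archimedean' a b h := by
    obtain ⟨a, rfl⟩ := mk_surjective a
    obtain ⟨b, rfl⟩ := mk_surjective b
    rw [zero_def, mk_le_mk_iff]
    intro B _ _ _ _ φ hφ
    simp only [Term.eval, map_zero]
    refine IsBal.archimedean' _ (b.eval φ) fun n => ?_
    obtain ⟨t', h1, h2⟩ := mk_nsmul_eval (w := w) n a
    rw [← h2 B φ]
    have h3 := h n
    rw [h1, mk_le_mk_iff] at h3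
    exact h3 B φ hφ

theorem isWeighted_of : IsWeighted w (of w) := by
  intro x
  refine le_of_forall_pos_le_add fun ε hε => ?_
  exact balNorm_le (by positivity) (abs_of_le x hε)

/-- The morphism induced by a weighted set morphism. -/
def lift {B : Type u} [CommRing B] [Lattice B] [Algebra ℝ B] [IsBal B] (φ : X → B)
    (hφ : IsWeighted w φ) : BalHom (FreeBal w) B where
  toFun := fun x => Quotient.liftOn x (fun t => t.eval φ) (fun _ _ h => h B φ hφ)
  map_one' := map_one (algebraMap ℝ B)
  map_zero' := map_zero (algebraMap ℝ B)
  map_add' := by rintro ⟨a⟩ ⟨b⟩; rfl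
  map_mul' := by rintro ⟨a⟩ ⟨b⟩; rfl
  commutes' _ := rfl
  map_sup' := by rintro ⟨a⟩ ⟨b⟩; rfl
  map_inf' := by rintro ⟨a⟩ ⟨b⟩; rfl

theorem hom_mk {B : Type*} [CommRing B] [Lattice B] [Algebra ℝ B]
    (α : BalHom (FreeBal w) B) (t : Term X) : α (mk w t) = t.eval (fun x => α (of w x)) := by
  induction t with
  | var x => rfl
  | const r => exact α.toAlgHom.commutes r
  | add s t hs ht =>
    rw [← mk_add]; exact (map_add α.toAlgHom _ _).trans (congrArg₂ (· + ·) hs ht)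
  | mul s t hs ht =>
    rw [← mk_mul]; exact (map_mul α.toAlgHom _ _).trans (congrArg₂ (· * ·) hs ht)
  | neg s hs => rw [← mk_neg]; exact (map_neg α.toAlgHom _).trans (congrArg (- ·) hs)
  | sup s t hs ht => rw [← mk_sup]; exact (α.map_sup' _ _).trans (congrArg₂ (· ⊔ ·) hs ht)
  | inf s t hs ht => rw [← mk_inf]; exact (α.map_inf' _ _).trans (congrArg₂ (· ⊓ ·) hs ht)

/-- The universal property: `FreeBal w` is the free bounded archimedean l-algebra over the weighted
set `(X, w)`. -/
theorem existsUnique_lift {B : Type u} [CommRing B] [Lattice B] [Algebra ℝ B] [IsBal B]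
    (φ : X → B) (hφ : IsWeighted w φ) :
    ∃! α : BalHom (FreeBal w) B, ∀ x, α (of w x) = φ x := by
  refine ⟨lift φ hφ, fun x => rfl, fun β hβ => ?_⟩
  have h : β.toAlgHom = (lift φ hφ).toAlgHom := by
    ext x
    obtain ⟨t, rfl⟩ := mk_surjective x
    exact (hom_mk β t).trans (congrArg (fun ψ => t.eval ψ) (funext hβ))
  cases β
  cases hl : lift φ hφ
  rw [hl] at h
  cases h
  rfl

end FreeBal

/-! ### The algebra `H(A)` -/

section H

variable (A : Type u) [CommRing A] [Lattice A] [Algebra ℝ A] [IsBal A]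

/-- The weight function `w_A(a) = max {‖a‖, 1}`. -/
def boxWeight (a : A) : ℝ≥0 := ⟨max (balNorm a) 1, le_max_of_le_right zero_le_one⟩

/-- The free algebra `F(A)` over the weighted set `(A, w_A)`. -/
abbrev FAlg : Type u := FreeBal (boxWeight A)

variable {A} in
/-- The canonical map `f_A : A → F(A)`. -/
def fGen (a : A) : FAlg A := FreeBal.of (boxWeight A) a

/-- The elements of `F(A)` that express the axioms of a modal operator. -/
inductive BoxRel : FAlg A → Prop
  | inf (a b : A) : BoxRel (fGen (a ⊓ b) - fGen a ⊓ fGen b)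
  | const (r : ℝ) : BoxRel (fGen (algebraMap ℝ A r) - algebraMap ℝ (FAlg A) r
      - (1 - algebraMap ℝ (FAlg A) r) * fGen 0)
  | pos (a : A) : BoxRel (fGen (a ⊔ 0) - (fGen a ⊔ 0))
  | add (a : A) (r : ℝ) : BoxRel (fGen (a + algebraMap ℝ A r) - fGen a
      - fGen (algebraMap ℝ A r) + fGen 0)
  | smul (r : ℝ) (a : A) : 0 ≤ r →
      BoxRel (fGen (r • a) - fGen (algebraMap ℝ A r) * fGen a)

/-- The algebra `H(A) = F(A) / I_A`, where `I_A` is the archimedean l-ideal generated by the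
elements in `BoxRel`. -/
abbrev HAlg : Type u := FAlg A ⧸ archSpan {x : FAlg A | BoxRel A x}

variable {A} in
/-- The elements `□_a = h_A(a)` of `H(A)`. -/
def box (a : A) : HAlg A := Ideal.Quotient.mk (archSpan {x : FAlg A | BoxRel A x}) (fGen a)

end H

/-! ### The Vietoris space -/

/-- The Vietoris space `V(X)`: the set of all closed subsets of `X` (the empty set included). -/
@[ext] structure Vietoris (X : Type*) [TopologicalSpace X] where
  /-- The underlying set. -/
  carrier : Set X
  isClosed' : IsClosed carrier

/-- The Vietoris topology, with subbasis the sets `{F | F ⊆ U}` and `{F | F ∩ U ≠ ∅}` for open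
`U`. -/
instance Vietoris.instTopologicalSpace (X : Type*) [TopologicalSpace X] :
    TopologicalSpace (Vietoris X) :=
  TopologicalSpace.generateFrom
    ({S | ∃ U : Set X, IsOpen U ∧ S = {F : Vietoris X | F.carrier ⊆ U}} ∪
      {S | ∃ U : Set X, IsOpen U ∧ S = {F : Vietoris X | (F.carrier ∩ U).Nonempty}})

theorem Vietoris.isInducing_carrier (X : Type*) [TopologicalSpace X] :
    @Topology.IsInducing (Vietoris X) (Set X) _ (TopologicalSpace.vietoris X)
      (fun F => F.carrier) := by
  letI := TopologicalSpace.vietoris X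
  constructor
  rw [TopologicalSpace.vietoris, induced_generateFrom_eq]
  refine congrArg TopologicalSpace.generateFrom ?_
  rw [Set.image_union, Set.image_image, Set.image_image]
  congr 1
  · ext S
    exact ⟨fun ⟨U, hU, h⟩ => ⟨U, hU, h.symm⟩, fun ⟨U, hU, h⟩ => ⟨U, hU, h.symm⟩⟩
  · ext S
    exact ⟨fun ⟨U, hU, h⟩ => ⟨U, hU, h.symm⟩, fun ⟨U, hU, h⟩ => ⟨U, hU, h.symm⟩⟩

instance Vietoris.instCompactSpace (X : Type*) [TopologicalSpace X] [CompactSpace X] :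
    CompactSpace (Vietoris X) := by
  letI := TopologicalSpace.vietoris X
  rw [← isCompact_univ_iff, (Vietoris.isInducing_carrier X).isCompact_iff,
    isCompact_iff_ultrafilter_le_nhds]
  intro f _
  obtain ⟨s, -, hs⟩ := isCompact_iff_ultrafilter_le_nhds.1
    (isCompact_univ : IsCompact (Set.univ : Set (Set X))) f (by simp)
  refine ⟨closure s, ⟨⟨closure s, isClosed_closure⟩, trivial, rfl⟩, hs.trans ?_⟩
  exact TopologicalSpace.vietoris.specializes_iff.2
    ⟨fun x hx => ⟨x, subset_closure hx, specializes_rfl⟩, le_rfl⟩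

open Classical in
/-- The function `F ↦ inf ζ_A(a)(F)` on the Vietoris space of `Y_A`, with value `1` at `∅`. -/
def infZeta {A : Type*} [CommRing A] [Lattice A] [Algebra ℝ A] [IsBal A] (a : A)
    (F : Vietoris (Yosida A)) : ℝ :=
  if F.carrier.Nonempty then sInf (zeta a '' F.carrier) else 1

end BalAlg

end

open BalAlg

noncomputable section

namespace BalAlg

universe u

/-! ### Morphisms -/

section Hom

/-! ### Morphisms, their kernels and the quotients they factor through -/

variable {A B C : Type*} [CommRing A] [Lattice A] [Algebra ℝ A]
  [CommRing B] [Lattice B] [Algebra ℝ B] [CommRing C] [Lattice C] [Algebra ℝ C]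

/-! A point `N` of the Yosida space of `H(A)` is the same thing as a morphism `H(A) → ℝ`, and this
is determined by the numbers `p(a) = ζ(□_a)(N)`. The defining relations of `H(A)` become conditions
on `p : A → ℝ`, so the theorem reduces to the claim that the functions `p` obeying them are exactly
`a ↦ inf ζ(a)(F)` for closed `F`, with the constant `1` for `F = ∅`.

Scaling by `r = 0` gives `p(0) = p(0) p(a)`. If `p(0) ≠ 0`, then `p` is constantly `1`, which is the
empty set. If `p(0) = 0`, the relation for constants gives `p(r) = r`, and `p` preserves binary
meets and positive parts, commutes with translations by constants and is positively homogeneous.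
Such a `p` is the infimum over the closed set `F` of all `M` with `p ≤ ζ(·)(M)`; that `F` is large
enough for `p(a)` to be attained is the compactness argument of `exists_infZeta_eq_of_map_zero`, the
core of the proof. It relies on `le_of_zeta_le`: the order of `A` is detected pointwise on the
Yosida space.

Conversely, infima over closed sets are continuous for the Vietoris topology and satisfy the
relations (`freeInfHom_boxRel`), which yields `η`. Distinct closed sets have distinct infima
(`Vietoris.subset_of_infZeta_eq`), so `F ↦ Y(η)(ε(F))` is a continuous bijection from a compact
space to a Hausdorff space. Since `ε` is surjective, `Y(η)` is bijective as well. -/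

theorem BalHom.ext {α β : BalHom A B} (h : ∀ a, α a = β a) : α = β := by
  have h' : α.toAlgHom = β.toAlgHom := AlgHom.ext h
  cases α
  cases β
  cases h'
  rfl

theorem BalHom.map_sup (α : BalHom A B) (a b : A) : α (a ⊔ b) = α a ⊔ α b := α.map_sup' a b

theorem BalHom.map_inf (α : BalHom A B) (a b : A) : α (a ⊓ b) = α a ⊓ α b := α.map_inf' a b

theorem BalHom.map_abs (α : BalHom A B) (a : A) : α |a| = |α a| := by
  rw [abs, α.map_sup, map_neg]
  rfl

theorem BalHom.monotone (α : BalHom A B) : Monotone α := fun a b h => by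
  rw [← sup_eq_right, ← α.map_sup, sup_eq_right.2 h]

/-- The composition of two morphisms. -/
def BalHom.comp (β : BalHom B C) (α : BalHom A B) : BalHom A C where
  toAlgHom := β.toAlgHom.comp α.toAlgHom
  map_sup' a b := (congrArg β (α.map_sup a b)).trans (β.map_sup _ _)
  map_inf' a b := (congrArg β (α.map_inf a b)).trans (β.map_inf _ _)

theorem isLIdeal_ker [IsOrderedAddMonoid B] (β : BalHom A B) :
    IsLIdeal (RingHom.ker β.toAlgHom) := by
  refine ⟨fun a b hab hb => ?_⟩
  rw [RingHom.mem_ker] at hb ⊢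
  have h := β.monotone hab
  rw [β.map_abs, β.map_abs, hb, abs_zero] at h
  exact le_antisymm ((le_abs_self _).trans h) (neg_nonpos.1 ((neg_le_abs _).trans h))

/-- The order of the quotient by the kernel is the one pulled back from `B`, so it inherits the
archimedean property. Hence a morphism that kills `S` kills all of `archSpan S`. -/
theorem isArchLIdeal_ker [IsOrderedRing A] [IsBal B] (β : BalHom A B) :
    IsArchLIdeal (RingHom.ker β.toAlgHom) := by
  have := isLIdeal_ker β
  have key : ∀ a b : A, Ideal.Quotient.mk (RingHom.ker β.toAlgHom) a ≤ Ideal.Quotient.mk _ b ↔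
      β a ≤ β b := fun a b => by
    rw [mk_le_mk_iff, RingHom.mem_ker, β.map_sup, map_sub, map_zero, sup_eq_right, sub_nonpos]
  refine ⟨this, fun x y h => ?_⟩
  obtain ⟨a, rfl⟩ := Ideal.Quotient.mk_surjective x
  obtain ⟨b, rfl⟩ := Ideal.Quotient.mk_surjective y
  rw [← map_zero (Ideal.Quotient.mk _), key, map_zero]
  refine IsBal.archimedean' _ (β b) fun n => ?_
  have h := h n
  rwa [← map_nsmul, key, map_nsmul] at h

/-- The quotient map onto the quotient by an archimedean l-ideal. -/
def mkHom [IsOrderedRing A] (S : Set A) : BalHom A (A ⧸ archSpan S) where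
  toAlgHom := Ideal.Quotient.mkₐ ℝ (archSpan S)
  map_sup' _ _ := rfl
  map_inf' _ _ := rfl

/-- The morphism induced on the quotient by the archimedean l-ideal generated by `S`. -/
def quotientLift [IsOrderedRing A] [IsBal B] (S : Set A) (β : BalHom A B)
    (h : ∀ s ∈ S, β s = 0) : BalHom (A ⧸ archSpan S) B where
  toAlgHom := Ideal.Quotient.liftₐ (archSpan S) β.toAlgHom
    fun _ ha => archSpan_le (isArchLIdeal_ker β) h ha
  map_sup' := by
    intro x y
    obtain ⟨a, rfl⟩ := Ideal.Quotient.mk_surjective x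
    obtain ⟨b, rfl⟩ := Ideal.Quotient.mk_surjective y
    exact β.map_sup a b
  map_inf' := by
    intro x y
    obtain ⟨a, rfl⟩ := Ideal.Quotient.mk_surjective x
    obtain ⟨b, rfl⟩ := Ideal.Quotient.mk_surjective y
    exact β.map_inf a b

end Hom

/-- Each element of `H(A)` is the class of a term, and morphisms commute with the evaluation of
terms. The target may lie in any universe, so the lemma applies to `ℝ`. -/
theorem HAlg.hom_ext {A : Type u} [CommRing A] [Lattice A] [Algebra ℝ A] [IsBal A]
    {B : Type*} [CommRing B] [Lattice B] [Algebra ℝ B] {α β : BalHom (HAlg A) B}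
    (h : ∀ a : A, α (box a) = β (box a)) : α = β := by
  refine BalHom.ext fun x => ?_
  obtain ⟨y, rfl⟩ := Ideal.Quotient.mk_surjective x
  obtain ⟨t, rfl⟩ := FreeBal.mk_surjective y
  refine (FreeBal.hom_mk (α.comp (mkHom _)) t).trans
    (Eq.trans ?_ (FreeBal.hom_mk (β.comp (mkHom _)) t).symm)
  exact congrArg (fun ψ => t.eval ψ) (funext h)

/-! ### Residues at the points of the Yosida space -/

section Residue

variable {A B : Type*} [CommRing A] [Lattice A] [Algebra ℝ A] [IsBal A]
  [CommRing B] [Lattice B] [Algebra ℝ B] [IsBal B]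

theorem zeta_eq_iff {a : A} {M : Yosida A} {r : ℝ} :
    zeta a M = r ↔ a - algebraMap ℝ A r ∈ M.1 :=
  ⟨fun h => h ▸ zeta_spec a M, fun h => (existsUnique_residue M a).unique (zeta_spec a M) h⟩

theorem zeta_eq_zero_iff {a : A} {M : Yosida A} : zeta a M = 0 ↔ a ∈ M.1 := by
  rw [zeta_eq_iff, map_zero, sub_zero]

theorem zeta_map (α : BalHom A B) (M : Yosida B) (a : A) :
    zeta a (Yosida.map α M) = zeta (α a) M := by
  rw [zeta_eq_iff]
  change α (a - algebraMap ℝ A _) ∈ M.1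
  rw [map_sub, AlgHom.commutes]
  exact zeta_spec _ _

theorem zeta_point {X : Type*} [TopologicalSpace X] [CompactSpace X] (f : C(X, ℝ)) (x : X) :
    zeta f (Yosida.point x) = f x := by
  rw [zeta_eq_iff]
  change (f - algebraMap ℝ C(X, ℝ) (f x)) x = 0
  simp

/-- The morphism `a ↦ ζ(a)(M)` to the reals. -/
def residueHom (M : Yosida A) : BalHom A ℝ where
  toFun a := zeta a M
  map_one' := by rw [zeta_eq_iff, map_one, sub_self]; exact M.1.zero_mem
  map_zero' := zeta_eq_zero_iff.2 M.1.zero_mem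
  map_add' a b := by
    rw [zeta_eq_iff, map_add, add_sub_add_comm]
    exact M.1.add_mem (zeta_spec a M) (zeta_spec b M)
  map_mul' a b := by
    rw [zeta_eq_iff, map_mul]
    -- With `r = ζ(a)` and `s = ζ(b)`: `ab - rs = a(b - s) + s(a - r)`.
    have := M.1.add_mem (M.1.mul_mem_left a (zeta_spec b M))
      (M.1.mul_mem_left (algebraMap ℝ A (zeta b M)) (zeta_spec a M))
    convert this using 1
    ring
  commutes' r := by
    rw [zeta_eq_iff, Algebra.algebraMap_self, RingHom.id_apply, sub_self]
    exact M.1.zero_mem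
  map_sup' a b := by
    have hmono : Monotone (algebraMap ℝ A) := fun _ _ => algebraMap_mono
    change zeta (a ⊔ b) M = zeta a M ⊔ zeta b M
    rw [zeta_eq_iff, hmono.map_sup]
    -- The arguments of the join are replaced by their residues one at a time; each replacement
    -- changes the join by an element of `M`.
    have h1 := M.2.prop.1.solid _ _ (abs_sup_sub_sup_le_abs a _ b) (zeta_spec a M)
    have h2 := M.2.prop.1.solid _ _
      (abs_sup_sub_sup_le_abs b _ (algebraMap ℝ A (zeta a M))) (zeta_spec b M)
    have := M.1.add_mem h1 h2
    rwa [sup_comm b, sub_add_sub_cancel, sup_comm (algebraMap ℝ A (zeta b M))] at this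
  map_inf' a b := by
    have hmono : Monotone (algebraMap ℝ A) := fun _ _ => algebraMap_mono
    change zeta (a ⊓ b) M = zeta a M ⊓ zeta b M
    rw [zeta_eq_iff, hmono.map_inf]
    have h1 := M.2.prop.1.solid _ _ (abs_inf_sub_inf_le_abs a _ b) (zeta_spec a M)
    have h2 := M.2.prop.1.solid _ _
      (abs_inf_sub_inf_le_abs b _ (algebraMap ℝ A (zeta a M))) (zeta_spec b M)
    have := M.1.add_mem h1 h2
    rwa [inf_comm b, sub_add_sub_cancel, inf_comm (algebraMap ℝ A (zeta b M))] at this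

theorem zeta_algebraMap (r : ℝ) (M : Yosida A) : zeta (algebraMap ℝ A r) M = r :=
  (residueHom M).toAlgHom.commutes r

theorem zeta_zero (M : Yosida A) : zeta (0 : A) M = 0 := map_zero (residueHom M).toAlgHom

theorem zeta_add (a b : A) (M : Yosida A) : zeta (a + b) M = zeta a M + zeta b M :=
  map_add (residueHom M).toAlgHom a b

theorem zeta_sub (a b : A) (M : Yosida A) : zeta (a - b) M = zeta a M - zeta b M :=
  map_sub (residueHom M).toAlgHom a b

theorem zeta_neg (a : A) (M : Yosida A) : zeta (-a) M = -zeta a M :=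
  map_neg (residueHom M).toAlgHom a

theorem zeta_mul (a b : A) (M : Yosida A) : zeta (a * b) M = zeta a M * zeta b M :=
  map_mul (residueHom M).toAlgHom a b

theorem zeta_smul (r : ℝ) (a : A) (M : Yosida A) : zeta (r • a) M = r * zeta a M :=
  map_smul (residueHom M).toAlgHom r a

theorem zeta_sup (a b : A) (M : Yosida A) : zeta (a ⊔ b) M = zeta a M ⊔ zeta b M :=
  (residueHom M).map_sup a b

theorem zeta_inf (a b : A) (M : Yosida A) : zeta (a ⊓ b) M = zeta a M ⊓ zeta b M :=
  (residueHom M).map_inf a b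

theorem zeta_abs (a : A) (M : Yosida A) : zeta |a| M = |zeta a M| := (residueHom M).map_abs a

theorem zeta_mono {a b : A} (h : a ≤ b) (M : Yosida A) : zeta a M ≤ zeta b M :=
  (residueHom M).monotone h

theorem abs_zeta_le (a : A) (M : Yosida A) : |zeta a M| ≤ balNorm a := by
  refine le_of_forall_pos_le_add fun ε hε => ?_
  have h := zeta_mono (abs_le_balNorm_add a hε) M
  rwa [zeta_abs, zeta_algebraMap] at h

theorem Yosida.ext_zeta {M N : Yosida A} (h : ∀ a : A, zeta a M = zeta a N) : M = N :=
  Subtype.ext (Ideal.ext fun a => by rw [← zeta_eq_zero_iff, ← zeta_eq_zero_iff, h])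

/-- An element that is not `≤ 0` is nonnegative at some maximal l-ideal. -/
theorem exists_zeta_nonneg {x : A} (h : ¬ x ≤ 0) : ∃ M : Yosida A, 0 ≤ zeta x M := by
  -- The polar of `x⁺` is proper because `x⁺ ≠ 0`, and it contains `x⁻`. At a maximal l-ideal above
  -- it, `x⁻` has residue `0`.
  have h1 : (1 : A) ∉ polar {x ⊔ 0} := by
    intro h1
    have h2 : x ⊔ 0 ∈ polar {x ⊔ 0} := (Ideal.eq_top_iff_one _).2 h1 ▸ Submodule.mem_top
    have h3 := mem_polar.1 h2 _ rfl
    rw [inf_idem, abs_of_nonneg le_sup_right] at h3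
    exact h (sup_eq_right.1 h3)
  obtain ⟨M, hle⟩ : ∃ M : Yosida A, polar {x ⊔ 0} ≤ M.1 := by
    obtain ⟨M, hle, hM⟩ := exists_le_isMaxLIdeal (isLIdeal_polar _) h1
    exact ⟨⟨M, hM⟩, hle⟩
  refine ⟨M, ?_⟩
  have h2 : (-x) ⊔ 0 ∈ polar {x ⊔ 0} := by
    rw [mem_polar]
    rintro _ rfl
    rw [abs_of_nonneg le_sup_right, abs_of_nonneg le_sup_right, inf_comm]
    exact posPart_inf_negPart_eq_zero x
  have h3 : zeta ((-x) ⊔ 0) M = 0 := zeta_eq_zero_iff.2 (hle h2)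
  rw [zeta_sup, zeta_neg, zeta_zero, sup_eq_right] at h3
  linarith

/-- If `n(a - b) ≤ 1` failed, then `n(a - b) - 1` would have a nonnegative residue somewhere,
although `ζ(a - b) ≤ 0` everywhere. The archimedean axiom absorbs the constant `1`, which is there
because `exists_zeta_nonneg` gives no strict inequality. -/
theorem le_of_zeta_le {a b : A} (h : ∀ M, zeta a M ≤ zeta b M) : a ≤ b := by
  rw [← sub_nonpos]
  refine IsBal.archimedean' _ 1 fun n => ?_
  by_contra hn
  rw [← sub_nonpos] at hn
  obtain ⟨M, hM⟩ := exists_zeta_nonneg hn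
  have h1 : zeta (1 : A) M = 1 := map_one (residueHom M).toAlgHom
  have h2 : zeta (n • (a - b)) M = n • zeta (a - b) M := map_nsmul (residueHom M).toAlgHom n _
  rw [zeta_sub, h1, h2, zeta_sub, nsmul_eq_mul] at hM
  have := mul_nonneg (Nat.cast_nonneg (α := ℝ) n) (sub_nonneg.2 (h M))
  linarith

/-! ### The topology of the Yosida space -/

theorem isClosed_setOf_mem (a : A) : IsClosed {M : Yosida A | a ∈ M.1} := by
  rw [Yosida.isClosed_iff]
  -- The l-ideal generated by `a`.
  refine ⟨sInf {J | IsLIdeal J ∧ a ∈ J}, isLIdeal_sInf fun J hJ => hJ.1, ?_⟩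
  ext M
  refine ⟨fun h => ?_, fun h => h (Submodule.mem_sInf.2 fun J hJ => hJ.2)⟩
  have hM : M.1 ∈ {J : Ideal A | IsLIdeal J ∧ a ∈ J} := ⟨M.2.prop.1, h⟩
  exact sInf_le hM

/-- The condition `ζ(a)(M) ≤ r` says that `(a - r)⁺` lies in `M`, which is closed; dually for `≥`.
-/
theorem continuous_zeta (a : A) : Continuous (zeta a) := by
  rw [OrderTopology.continuous_iff]
  intro r
  constructor
  · rw [← isClosed_compl_iff]
    convert isClosed_setOf_mem ((a - algebraMap ℝ A r) ⊔ 0) using 1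
    ext M
    rw [Set.mem_ofPred_eq, ← zeta_eq_zero_iff, zeta_sup, zeta_sub, zeta_algebraMap, zeta_zero]
    simp
  · rw [← isClosed_compl_iff]
    convert isClosed_setOf_mem ((algebraMap ℝ A r - a) ⊔ 0) using 1
    ext M
    rw [Set.mem_ofPred_eq, ← zeta_eq_zero_iff, zeta_sup, zeta_sub, zeta_algebraMap, zeta_zero]
    simp

instance Yosida.instT2Space : T2Space (Yosida A) := by
  refine ⟨fun M N hMN => ?_⟩
  obtain ⟨a, ha⟩ : ∃ a : A, zeta a M ≠ zeta a N := by
    by_contra! h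
    exact hMN (Yosida.ext_zeta h)
  exact separated_by_continuous (continuous_zeta a) ha

/-- The closed set `Z(I)` is the common zero set of the functions `ζ(a)`, `a ∈ I`, so these
functions induce the topology. -/
theorem Yosida.continuous_of_zeta {X : Type*} [TopologicalSpace X] {f : X → Yosida A}
    (h : ∀ a : A, Continuous fun x => zeta a (f x)) : Continuous f := by
  rw [continuous_iff_isClosed]
  intro Z hZ
  obtain ⟨I, -, rfl⟩ := Yosida.isClosed_iff.1 hZ
  have : f ⁻¹' Yosida.zeroSet I = ⋂ a ∈ I, {x | zeta a (f x) = 0} := by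
    ext x
    simp only [Set.mem_iInter, Set.mem_ofPred_eq, zeta_eq_zero_iff]
    rfl
  rw [this]
  exact isClosed_biInter fun a _ => isClosed_eq (h a) continuous_const

theorem Yosida.continuous_map (α : BalHom A B) : Continuous (Yosida.map α) :=
  Yosida.continuous_of_zeta fun a => by simpa only [zeta_map] using continuous_zeta (α a)

theorem Yosida.continuous_point (X : Type*) [TopologicalSpace X] [CompactSpace X] :
    Continuous (Yosida.point : X → Yosida C(X, ℝ)) :=
  Yosida.continuous_of_zeta fun f => by simpa only [zeta_point] using f.continuous

/-- The zero sets of members of `M` are directed, since `f² + g²` vanishes only where both do, and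
nonempty, since a nowhere vanishing function is a unit. Compactness gives a common zero `x`, and
maximality gives `M = ε(x)`. No separation axiom on `X` is needed. -/
theorem Yosida.surjective_point (X : Type*) [TopologicalSpace X] [CompactSpace X] :
    Function.Surjective (Yosida.point : X → Yosida C(X, ℝ)) := by
  intro M
  have key : (⋂ f : {f : C(X, ℝ) // f ∈ M.1}, {x | f.1 x = 0}).Nonempty := by
    refine IsCompact.nonempty_iInter_of_directed_nonempty_isCompact_isClosed _ ?_ ?_
      (fun f => (isClosed_eq f.1.continuous continuous_const).isCompact)
      (fun f => isClosed_eq f.1.continuous continuous_const)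
    · intro f g
      refine ⟨⟨f.1 * f.1 + g.1 * g.1, M.1.add_mem (M.1.mul_mem_left _ f.2)
        (M.1.mul_mem_left _ g.2)⟩, fun x hx => ?_, fun x hx => ?_⟩ <;>
      · have hx : f.1 x * f.1 x + g.1 x * g.1 x = 0 := hx
        change _ = (0 : ℝ)
        nlinarith [mul_self_nonneg (f.1 x), mul_self_nonneg (g.1 x)]
    · rintro ⟨f, hf⟩
      by_contra hne
      have hf0 : ∀ x, f x ≠ 0 := fun x hx => hne ⟨x, hx⟩
      refine M.2.one_notMem ?_
      have := M.1.mul_mem_left ⟨fun x => (f x)⁻¹, f.continuous.inv₀ hf0⟩ hf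
      convert this using 1
      ext x
      exact (inv_mul_cancel₀ (hf0 x)).symm
  obtain ⟨x, hx⟩ := key
  refine ⟨x, (Subtype.ext (M.2.eq_of_le (Yosida.point x).2.prop fun f hf => ?_)).symm⟩
  exact Set.mem_iInter.1 hx ⟨f, hf⟩

end Residue

/-! ### The functions `inf ζ(a)` on the Vietoris space -/

section InfZeta

variable {A : Type*} [CommRing A] [Lattice A] [Algebra ℝ A] [IsBal A]

theorem Vietoris.isOpen_subset {X : Type*} [TopologicalSpace X] {U : Set X} (hU : IsOpen U) :
    IsOpen {F : Vietoris X | F.carrier ⊆ U} :=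
  TopologicalSpace.isOpen_generateFrom_of_mem (Or.inl ⟨U, hU, rfl⟩)

theorem Vietoris.isOpen_inter_nonempty {X : Type*} [TopologicalSpace X] {U : Set X}
    (hU : IsOpen U) : IsOpen {F : Vietoris X | (F.carrier ∩ U).Nonempty} :=
  TopologicalSpace.isOpen_generateFrom_of_mem (Or.inr ⟨U, hU, rfl⟩)

theorem infZeta_of_not_nonempty (a : A) {F : Vietoris (Yosida A)} (hF : ¬ F.carrier.Nonempty) :
    infZeta a F = 1 := if_neg hF

/-- A nonempty closed set is compact, so the infimum is a minimum; the later computations all work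
at a minimizing point. -/
theorem isLeast_infZeta (a : A) {F : Vietoris (Yosida A)} (hF : F.carrier.Nonempty) :
    IsLeast (zeta a '' F.carrier) (infZeta a F) := by
  rw [infZeta, if_pos hF]
  exact (F.isClosed'.isCompact.image (continuous_zeta a)).isLeast_sInf (hF.image _)

theorem infZeta_le (a : A) {F : Vietoris (Yosida A)} {M : Yosida A} (hM : M ∈ F.carrier) :
    infZeta a F ≤ zeta a M :=
  (isLeast_infZeta a ⟨M, hM⟩).2 ⟨M, hM, rfl⟩

theorem exists_zeta_eq_infZeta (a : A) {F : Vietoris (Yosida A)} (hF : F.carrier.Nonempty) :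
    ∃ M ∈ F.carrier, zeta a M = infZeta a F :=
  (isLeast_infZeta a hF).1

theorem infZeta_eq {a : A} {F : Vietoris (Yosida A)} {M : Yosida A} (hM : M ∈ F.carrier)
    (h : ∀ N ∈ F.carrier, zeta a M ≤ zeta a N) : infZeta a F = zeta a M := by
  obtain ⟨N, hN, hNa⟩ := exists_zeta_eq_infZeta a ⟨M, hM⟩
  exact le_antisymm (infZeta_le a hM) (hNa ▸ h N hN)

/-- For nonempty `F`, the minimum exceeds `r` iff `F ⊆ {ζ(a) > r}`, and it is below `r` iff `F`
meets `{ζ(a) < r}`. Since `∅` is an isolated point, its value does no harm. -/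
theorem continuous_infZeta (a : A) : Continuous (infZeta a) := by
  rw [OrderTopology.continuous_iff]
  intro r
  have hgt := Vietoris.isOpen_subset (isOpen_lt continuous_const (continuous_zeta a) : IsOpen
    {M | r < zeta a M})
  have hlt := Vietoris.isOpen_inter_nonempty (isOpen_lt (continuous_zeta a) continuous_const :
    IsOpen {M | zeta a M < r})
  have hne : IsOpen {F : Vietoris (Yosida A) | F.carrier.Nonempty} := by
    simpa using Vietoris.isOpen_inter_nonempty (X := Yosida A) isOpen_univ
  have hemp : IsOpen {F : Vietoris (Yosida A) | ¬ F.carrier.Nonempty} := by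
    simpa [Set.not_nonempty_iff_eq_empty] using
      Vietoris.isOpen_subset (X := Yosida A) isOpen_empty
  constructor
  · have h : infZeta a ⁻¹' Set.Ioi r = {F : Vietoris (Yosida A) | F.carrier ⊆ {M | r < zeta a M}} ∩
        ({F | F.carrier.Nonempty} ∪ {_F | r < 1}) := by
      ext F
      by_cases hF : F.carrier.Nonempty
      · obtain ⟨M, hM, hMa⟩ := exists_zeta_eq_infZeta a hF
        refine ⟨fun h => ⟨fun N hN => lt_of_lt_of_le h (infZeta_le a hN), Or.inl hF⟩, fun h => ?_⟩
        have := h.1 hM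
        rwa [Set.mem_preimage, ← hMa]
      · have := Set.not_nonempty_iff_eq_empty.1 hF
        simp [infZeta_of_not_nonempty a hF, this]
    rw [h]
    exact hgt.inter (hne.union isOpen_const)
  · have h : infZeta a ⁻¹' Set.Iio r =
        {F : Vietoris (Yosida A) | (F.carrier ∩ {M | zeta a M < r}).Nonempty} ∪
        ({F | ¬ F.carrier.Nonempty} ∩ {_F | 1 < r}) := by
      ext F
      by_cases hF : F.carrier.Nonempty
      · obtain ⟨M, hM, hMa⟩ := exists_zeta_eq_infZeta a hF
        refine ⟨fun h => Or.inl ⟨M, hM, hMa.trans_lt h⟩, ?_⟩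
        rintro (⟨N, hN, hNr⟩ | h)
        · exact (infZeta_le a hN).trans_lt hNr
        · exact absurd hF h.1
      · have := Set.not_nonempty_iff_eq_empty.1 hF
        simp [infZeta_of_not_nonempty a hF, this]
    rw [h]
    exact hlt.union (hemp.inter isOpen_const)

/-- The `1` in the weight accounts for the value at `∅`. -/
theorem abs_infZeta_le (a : A) (F : Vietoris (Yosida A)) : |infZeta a F| ≤ max (balNorm a) 1 := by
  by_cases hF : F.carrier.Nonempty
  · obtain ⟨M, -, hM⟩ := exists_zeta_eq_infZeta a hF
    exact hM ▸ (abs_zeta_le a M).trans (le_max_left _ _)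
  · rw [infZeta_of_not_nonempty a hF, abs_one]
    exact le_max_right _ _

/-! ### Modal identities for the infimum -/

theorem infZeta_algebraMap (r : ℝ) {F : Vietoris (Yosida A)} (hF : F.carrier.Nonempty) :
    infZeta (algebraMap ℝ A r) F = r := by
  obtain ⟨M, -, hM⟩ := exists_zeta_eq_infZeta (algebraMap ℝ A r) hF
  rw [← hM, zeta_algebraMap]

theorem infZeta_zero {F : Vietoris (Yosida A)} (hF : F.carrier.Nonempty) :
    infZeta (0 : A) F = 0 := by
  simpa using infZeta_algebraMap (A := A) 0 hF

theorem infZeta_inf (a b : A) (F : Vietoris (Yosida A)) :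
    infZeta (a ⊓ b) F = infZeta a F ⊓ infZeta b F := by
  by_cases hF : F.carrier.Nonempty
  · obtain ⟨M, hM, hMa⟩ := exists_zeta_eq_infZeta a hF
    obtain ⟨N, hN, hNb⟩ := exists_zeta_eq_infZeta b hF
    obtain ⟨K, hK, hKab⟩ := exists_zeta_eq_infZeta (a ⊓ b) hF
    apply le_antisymm
    · refine le_inf ?_ ?_
      · exact (infZeta_le _ hM).trans (hMa ▸ zeta_mono inf_le_left M)
      · exact (infZeta_le _ hN).trans (hNb ▸ zeta_mono inf_le_right N)
    · rw [← hKab, zeta_inf]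
      exact inf_le_inf (infZeta_le a hK) (infZeta_le b hK)
  · simp only [infZeta_of_not_nonempty _ hF, inf_idem]

/-- The map `t ↦ t ⊔ 0` is monotone, so a point that minimizes `ζ(a)` also minimizes `ζ(a ⊔ 0)`.
Translation and nonnegative scaling are treated alike below, but there the plain identities need `F
≠ ∅`. -/
theorem infZeta_posPart (a : A) (F : Vietoris (Yosida A)) :
    infZeta (a ⊔ 0) F = infZeta a F ⊔ 0 := by
  by_cases hF : F.carrier.Nonempty
  · obtain ⟨M, hM, hMa⟩ := exists_zeta_eq_infZeta a hF
    rw [← hMa, ← zeta_zero M, ← zeta_sup]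
    refine infZeta_eq hM fun N hN => ?_
    rw [zeta_sup, zeta_sup, zeta_zero, zeta_zero, hMa]
    exact sup_le_sup_right (infZeta_le a hN) 0
  · simp [infZeta_of_not_nonempty _ hF]

theorem infZeta_add_algebraMap (a : A) (r : ℝ) {F : Vietoris (Yosida A)}
    (hF : F.carrier.Nonempty) : infZeta (a + algebraMap ℝ A r) F = infZeta a F + r := by
  obtain ⟨M, hM, hMa⟩ := exists_zeta_eq_infZeta a hF
  have h : ∀ N, zeta (a + algebraMap ℝ A r) N = zeta a N + r := fun N => by
    rw [zeta_add, zeta_algebraMap]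
  rw [← hMa, ← h]
  refine infZeta_eq hM fun N hN => ?_
  rw [h, h, hMa]
  linarith [infZeta_le a hN]

theorem infZeta_smul {r : ℝ} (hr : 0 ≤ r) (a : A) {F : Vietoris (Yosida A)}
    (hF : F.carrier.Nonempty) : infZeta (r • a) F = r * infZeta a F := by
  obtain ⟨M, hM, hMa⟩ := exists_zeta_eq_infZeta a hF
  rw [← hMa, ← zeta_smul]
  refine infZeta_eq hM fun N hN => ?_
  rw [zeta_smul, zeta_smul, hMa]
  exact mul_le_mul_of_nonneg_left (infZeta_le a hN) hr

/-- Let `G = Z(I)`. For `a ∈ I` the infimum of `-|a|` over `G` is `0`, hence also over `F`, so `a`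
vanishes on `F`. The element `0` separates `∅` from the other closed sets. -/
theorem Vietoris.subset_of_infZeta_eq {F G : Vietoris (Yosida A)}
    (h : ∀ a : A, infZeta a F = infZeta a G) : F.carrier ⊆ G.carrier := by
  intro M hM
  have hG : G.carrier.Nonempty := by
    by_contra hG
    have := h 0
    rw [infZeta_zero ⟨M, hM⟩, infZeta_of_not_nonempty _ hG] at this
    exact zero_ne_one this
  obtain ⟨I, -, hI⟩ := Yosida.isClosed_iff.1 G.isClosed'
  rw [hI]
  intro a ha
  obtain ⟨N, hN, hNa⟩ := exists_zeta_eq_infZeta (-|a|) hG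
  rw [hI] at hN
  have h1 : zeta a N = 0 := zeta_eq_zero_iff.2 (hN ha)
  have h2 := infZeta_le (-|a|) hM
  rw [h, ← hNa, zeta_neg, zeta_abs, h1, abs_zero, zeta_neg, zeta_abs, neg_zero,
    neg_nonneg, abs_nonpos_iff] at h2
  exact zeta_eq_zero_iff.1 h2

/-- A modal functional that vanishes at `0` is the infimum over a nonempty closed set. -/
theorem exists_infZeta_eq_of_map_zero (p : A → ℝ) (h0 : p 0 = 0)
    (hinf : ∀ a b, p (a ⊓ b) = p a ⊓ p b) (hpos : ∀ a, p (a ⊔ 0) = p a ⊔ 0)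
    (hadd : ∀ a r, p (a + algebraMap ℝ A r) = p a + r)
    (hsmul : ∀ (r : ℝ) a, 0 ≤ r → p (r • a) = r * p a) :
    ∃ F : Vietoris (Yosida A), ∀ a, infZeta a F = p a := by
  have hmono : ∀ a b, a ≤ b → p a ≤ p b := fun a b hab => by
    rw [← inf_eq_left, ← hinf, inf_eq_left.2 hab]
  -- The largest set whose infima can all be at least `p`; it remains to see that each `p a` is
  -- attained on it.
  let F : Vietoris (Yosida A) := ⟨{M | ∀ a, p a ≤ zeta a M}, by
    rw [Set.ofPred_forall]
    exact isClosed_iInter fun a => isClosed_le continuous_const (continuous_zeta a)⟩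
  have key : ∀ a, ∃ M ∈ F.carrier, zeta a M = p a := by
    intro a
    -- `p a' = 0`, and `ζ(a')(M) = 0` means `ζ(a)(M) ≤ p a`.
    let a' : A := (a - algebraMap ℝ A (p a)) ⊔ 0
    have ha' : p a' = 0 := by
      rw [hpos, sub_eq_add_neg, ← map_neg, hadd]
      simp
    have ha'0 : ∀ M, 0 ≤ zeta a' M := fun M => by
      rw [← zeta_zero M]
      exact zeta_mono le_sup_right M
    -- A point in all these sets has `ζ(c) ≥ 0` whenever `p c = 0`, and, from `c = 0`, also `ζ(a') =
    -- 0`. The slack `1/(n+1)` makes each single set nonempty and disappears in the limit.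
    let T : {c : A // p c = 0} × ℕ → Set (Yosida A) := fun i =>
      {M | (i.2 + 1 : ℝ) * zeta a' M ≤ zeta i.1.1 M + ((i.2 : ℝ) + 1)⁻¹}
    have hT : ∀ i, IsClosed (T i) := fun i => isClosed_le
      (continuous_const.mul (continuous_zeta a')) ((continuous_zeta _).add continuous_const)
    have hne : (⋂ i, T i).Nonempty := by
      have : Nonempty ({c : A // p c = 0} × ℕ) := ⟨⟨0, h0⟩, 0⟩
      refine IsCompact.nonempty_iInter_of_directed_nonempty_isCompact_isClosed T ?_ ?_
        (fun i => (hT i).isCompact) hT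
      -- The condition gets stronger as `c` decreases and `n` grows, and `p (c ⊓ d) = 0` when `p c =
      -- p d = 0`.
      · have haux : ∀ (c d : A) (m n : ℕ) (M : Yosida A), c ≤ d → m ≤ n →
            (n + 1 : ℝ) * zeta a' M ≤ zeta c M + ((n : ℝ) + 1)⁻¹ →
            (m + 1 : ℝ) * zeta a' M ≤ zeta d M + ((m : ℝ) + 1)⁻¹ := by
          intro c d m n M hcd hmn h
          have hmn' : (m : ℝ) + 1 ≤ n + 1 := by exact_mod_cast Nat.succ_le_succ hmn
          calc (m + 1 : ℝ) * zeta a' M ≤ (n + 1) * zeta a' M :=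
                mul_le_mul_of_nonneg_right hmn' (ha'0 M)
            _ ≤ zeta c M + ((n : ℝ) + 1)⁻¹ := h
            _ ≤ zeta d M + ((m : ℝ) + 1)⁻¹ :=
                add_le_add (zeta_mono hcd M) (inv_anti₀ (by positivity) hmn')
        rintro ⟨⟨c, hc⟩, m⟩ ⟨⟨d, hd⟩, n⟩
        exact ⟨⟨⟨c ⊓ d, by rw [hinf, hc, hd, inf_idem]⟩, max m n⟩,
          fun M => haux _ _ _ _ M inf_le_left (le_max_left _ _),
          fun M => haux _ _ _ _ M inf_le_right (le_max_right _ _)⟩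
      · rintro ⟨⟨c, hc⟩, n⟩
        by_contra hempty
        have hn : (0 : ℝ) < n + 1 := by positivity
        -- If the set is empty, the reverse inequality holds at every point, hence in `A`. Applying
        -- `p` gives `1/(n+1) ≤ 0`.
        have hle : c + algebraMap ℝ A ((n : ℝ) + 1)⁻¹ ≤ ((n : ℝ) + 1) • a' := by
          refine le_of_zeta_le fun M => ?_
          rw [zeta_add, zeta_algebraMap, zeta_smul]
          exact (not_le.1 fun hM => hempty ⟨M, hM⟩).le
        have := hmono _ _ hle
        rw [hadd, hc, hsmul _ _ hn.le, ha', mul_zero, zero_add] at this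
        exact absurd this (not_le.2 (inv_pos.2 hn))
    obtain ⟨M, hM⟩ := hne
    have hM' : ∀ (c : A) (n : ℕ), p c = 0 →
        (n + 1 : ℝ) * zeta a' M ≤ zeta c M + ((n : ℝ) + 1)⁻¹ :=
      fun c n hc => Set.mem_iInter.1 hM (⟨c, hc⟩, n)
    have hF : M ∈ F.carrier := by
      intro b
      -- Applied to `c = b - p b`, the condition `ζ(c) ≥ 0` becomes `p b ≤ ζ(b)`.
      have hb : p (b + algebraMap ℝ A (-p b)) = 0 := by rw [hadd, add_neg_cancel]
      have h1 : ∀ n : ℕ, -zeta (b + algebraMap ℝ A (-p b)) M ≤ 1 / ((n : ℝ) + 1) := fun n => by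
        have h2 := hM' _ n hb
        have h3 : 0 ≤ (n + 1 : ℝ) * zeta a' M := mul_nonneg (by positivity) (ha'0 M)
        rw [one_div]
        linarith
      have h2 := ge_of_tendsto' tendsto_one_div_add_atTop_nhds_zero_nat h1
      rw [zeta_add, zeta_algebraMap] at h2
      linarith
    refine ⟨M, hF, le_antisymm ?_ (hF a)⟩
    have h1 : ∀ n : ℕ, zeta a' M ≤ 1 / ((n : ℝ) + 1) := fun n => by
      have h2 := hM' 0 n h0
      rw [zeta_zero, zero_add] at h2
      have h3 : zeta a' M ≤ (n + 1 : ℝ) * zeta a' M :=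
        le_mul_of_one_le_left (ha'0 M) (by simp)
      rw [one_div]
      exact h3.trans h2
    have h2 := ge_of_tendsto' tendsto_one_div_add_atTop_nhds_zero_nat h1
    have h3 : zeta (a - algebraMap ℝ A (p a)) M ≤ 0 := (zeta_mono le_sup_left M).trans h2
    rw [zeta_sub, zeta_algebraMap] at h3
    linarith
  refine ⟨F, fun a => ?_⟩
  obtain ⟨M, hM, hMa⟩ := key a
  rw [← hMa]
  exact infZeta_eq hM fun N hN => hMa ▸ hN a

end InfZeta

/-! ### The Yosida space of `H(A)` -/

section YosidaH

variable {A : Type u} [CommRing A] [Lattice A] [Algebra ℝ A] [IsBal A]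

/-! ### The defining relations, read in `H(A)` -/

theorem mk_eq_of_boxRel {x y : FAlg A} (h : BoxRel A (x - y)) :
    Ideal.Quotient.mk (archSpan {x : FAlg A | BoxRel A x}) x = Ideal.Quotient.mk _ y :=
  Ideal.Quotient.eq.2 (subset_archSpan _ h)

theorem box_inf (a b : A) : box (a ⊓ b) = box a ⊓ box b := mk_eq_of_boxRel (.inf a b)

theorem box_posPart (a : A) : box (a ⊔ 0) = box a ⊔ 0 := mk_eq_of_boxRel (.pos a)

theorem box_algebraMap (r : ℝ) : box (algebraMap ℝ A r) =
    algebraMap ℝ (HAlg A) r + (1 - algebraMap ℝ (HAlg A) r) * box 0 := by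
  refine mk_eq_of_boxRel (y := algebraMap ℝ (FAlg A) r + (1 - algebraMap ℝ (FAlg A) r) * fGen 0) ?_
  rw [← sub_sub]
  exact .const r

theorem box_add_algebraMap (a : A) (r : ℝ) :
    box (a + algebraMap ℝ A r) = box a + box (algebraMap ℝ A r) - box 0 := by
  refine mk_eq_of_boxRel (y := fGen a + fGen (algebraMap ℝ A r) - fGen 0) ?_
  have := BoxRel.add a r
  convert this using 1
  ring

theorem box_smul {r : ℝ} (hr : 0 ≤ r) (a : A) :
    box (r • a) = box (algebraMap ℝ A r) * box a := mk_eq_of_boxRel (.smul r a hr)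

/-- The values of the elements `□_a` at a point of the Yosida space of `H(A)` are the infima
over a closed set. -/
theorem exists_infZeta_eq_zeta_box (N : Yosida (HAlg A)) :
    ∃ F : Vietoris (Yosida A), ∀ a : A, infZeta a F = zeta (box a) N := by
  have hsmul : ∀ (r : ℝ) (a : A), 0 ≤ r →
      zeta (box (r • a)) N = zeta (box (algebraMap ℝ A r)) N * zeta (box a) N := fun r a hr => by
    rw [box_smul hr, zeta_mul]
  by_cases h0 : zeta (box (0 : A)) N = 0
  -- With `□_0` vanishing at `N`, constants are fixed, and the relations become the hypotheses of
  -- `exists_infZeta_eq_of_map_zero`.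
  · have hconst : ∀ r : ℝ, zeta (box (algebraMap ℝ A r)) N = r := fun r => by
      rw [box_algebraMap, zeta_add, zeta_mul, h0, mul_zero, zeta_algebraMap, add_zero]
    refine exists_infZeta_eq_of_map_zero (fun a => zeta (box a) N) h0 (fun a b => ?_) (fun a => ?_)
      (fun a r => ?_) (fun r a hr => ?_)
    · rw [box_inf, zeta_inf]
    · rw [box_posPart, zeta_sup, zeta_zero]
    · rw [box_add_algebraMap, zeta_sub, zeta_add, h0, hconst, sub_zero]
    · rw [hsmul r a hr, hconst]
  · refine ⟨⟨∅, isClosed_empty⟩, fun a => ?_⟩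
    rw [infZeta_of_not_nonempty a Set.not_nonempty_empty]
    -- Scaling by `0` reads `p(0) = p(0) p(a)`; cancelling `p(0) ≠ 0` leaves `p(a) = 1`.
    have h := hsmul 0 a le_rfl
    rw [zero_smul, map_zero] at h
    exact (mul_left_cancel₀ h0 (by rw [mul_one]; exact h))

variable (A) in
/-- The morphism `F(A) → C(V(Y_A))` that maps the generator `f_A(a)` to `inf ζ(a)`. -/
def freeInfHom : BalHom (FAlg A) C(Vietoris (Yosida A), ℝ) :=
  FreeBal.lift (fun a => ⟨infZeta a, continuous_infZeta a⟩) fun a =>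
    balNorm_le (NNReal.coe_nonneg _) fun F => by
      change |(⟨infZeta a, continuous_infZeta a⟩ : C(Vietoris (Yosida A), ℝ))| F ≤ _
      rw [ContinuousMap.abs_apply]
      refine (abs_infZeta_le a F).trans (le_of_eq ?_)
      change _ = (algebraMap ℝ C(Vietoris (Yosida A), ℝ) (boxWeight A a)) F
      rw [algebraMap_apply, smul_eq_mul, mul_one]
      rfl

theorem freeInfHom_fGen (a : A) (F : Vietoris (Yosida A)) :
    freeInfHom A (fGen a) F = infZeta a F := rfl

/-- On nonempty `F` the generator of `0` has value `0`, and the relations are the modal identities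
above. At `∅` every generator has value `1`; the terms in `f_A(0)` and the factor `f_A(r)` in place
of `r` make the relations hold there too, e.g. `1 - r - (1 - r) · 1 = 0`. -/
theorem freeInfHom_boxRel {x : FAlg A} (h : BoxRel A x) : freeInfHom A x = 0 := by
  ext F
  cases h with
  | inf a b =>
    rw [map_sub, BalHom.map_inf]
    exact sub_eq_zero.2 (infZeta_inf a b F)
  | const r =>
    simp only [map_sub, map_mul, map_one, AlgHom.commutes, ContinuousMap.sub_apply,
      ContinuousMap.mul_apply, freeInfHom_fGen, ContinuousMap.zero_apply, ContinuousMap.one_apply,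
      algebraMap_apply, smul_eq_mul, mul_one]
    by_cases hF : F.carrier.Nonempty
    · rw [infZeta_algebraMap r hF, infZeta_zero hF]; ring
    · simp only [infZeta_of_not_nonempty _ hF]; ring
  | pos a =>
    rw [map_sub, BalHom.map_sup, map_zero]
    exact sub_eq_zero.2 (infZeta_posPart a F)
  | add a r =>
    simp only [map_sub, map_add, ContinuousMap.sub_apply, ContinuousMap.add_apply,
      freeInfHom_fGen, ContinuousMap.zero_apply]
    by_cases hF : F.carrier.Nonempty
    · rw [infZeta_algebraMap r hF, infZeta_zero hF, infZeta_add_algebraMap a r hF]; ring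
    · simp only [infZeta_of_not_nonempty _ hF]; ring
  | smul r a hr =>
    simp only [map_sub, map_mul, ContinuousMap.sub_apply, ContinuousMap.mul_apply,
      freeInfHom_fGen, ContinuousMap.zero_apply]
    by_cases hF : F.carrier.Nonempty
    · rw [infZeta_algebraMap r hF, infZeta_smul hr a hF]; ring
    · simp only [infZeta_of_not_nonempty _ hF]; ring

variable (A) in
/-- The morphism `η_A : H(A) → C(V(Y_A))`. -/
def boxInfHom : BalHom (HAlg A) C(Vietoris (Yosida A), ℝ) :=
  quotientLift _ (freeInfHom A) fun _ h => freeInfHom_boxRel h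

theorem boxInfHom_box (a : A) (F : Vietoris (Yosida A)) : boxInfHom A (box a) F = infZeta a F :=
  rfl

/-! ### The comparison of the two spaces -/

theorem zeta_box_map_point (a : A) (F : Vietoris (Yosida A)) :
    zeta (box a) (Yosida.map (boxInfHom A) (Yosida.point F)) = infZeta a F := by
  rw [zeta_map, zeta_point, boxInfHom_box]

theorem Yosida.ext_zeta_box {M N : Yosida (HAlg A)}
    (h : ∀ a : A, zeta (box a) M = zeta (box a) N) : M = N := by
  have : residueHom M = residueHom N := HAlg.hom_ext h
  exact Yosida.ext_zeta fun x => congrArg (fun α : BalHom (HAlg A) ℝ => α x) this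

theorem bijective_map_point : Function.Bijective
    (fun F : Vietoris (Yosida A) => Yosida.map (boxInfHom A) (Yosida.point F)) := by
  constructor
  · intro F G h
    have h' : ∀ a : A, infZeta a F = infZeta a G := fun a => by
      rw [← zeta_box_map_point, ← zeta_box_map_point]
      exact congrArg (zeta (box a)) h
    exact Vietoris.ext ((Vietoris.subset_of_infZeta_eq h').antisymm
      (Vietoris.subset_of_infZeta_eq fun a => (h' a).symm))
  · intro N
    obtain ⟨F, hF⟩ := exists_infZeta_eq_zeta_box N
    exact ⟨F, Yosida.ext_zeta_box fun a => (zeta_box_map_point a F).trans (hF a)⟩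

/-- A continuous bijection from the compact space `V(Y_A)` to a Hausdorff Yosida space. That
`V(Y_A)` is Hausdorff is a consequence, not an input. -/
theorem isHomeomorph_map_point : IsHomeomorph
    (fun F : Vietoris (Yosida A) => Yosida.map (boxInfHom A) (Yosida.point F)) :=
  isHomeomorph_iff_continuous_bijective.2
    ⟨(Yosida.continuous_map _).comp (Yosida.continuous_point _), bijective_map_point⟩

/-- Because `ε` is surjective, injectivity of `Y(η) ∘ ε` passes to `Y(η)`; surjectivity passes in
any case. Both Yosida spaces are compact Hausdorff. -/
theorem isHomeomorph_map : IsHomeomorph (Yosida.map (boxInfHom A)) := by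
  refine isHomeomorph_iff_continuous_bijective.2 ⟨Yosida.continuous_map _, ?_, ?_⟩
  · exact Function.Injective.of_comp_right (g := Yosida.point) bijective_map_point.1
      (Yosida.surjective_point _)
  · exact Function.Surjective.of_comp (g := Yosida.point) bijective_map_point.2

end YosidaH

end BalAlg

end

theorem mainTheorem3 (A : Type*) [CommRing A] [Lattice A] [Algebra ℝ A] [IsBal A] :
    Nonempty (Yosida (HAlg A) ≃ₜ Vietoris (Yosida A)) ∧
    ∃ η : BalHom (HAlg A) C(Vietoris (Yosida A), ℝ),
      (∀ (a : A) (F : Vietoris (Yosida A)), η (box a) F = infZeta a F) ∧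
      (∀ η' : BalHom (HAlg A) C(Vietoris (Yosida A), ℝ),
        (∀ (a : A) (F : Vietoris (Yosida A)), η' (box a) F = infZeta a F) → η' = η) ∧
      IsHomeomorph (Yosida.map η) ∧
      IsHomeomorph (fun F : Vietoris (Yosida A) => Yosida.map η (Yosida.point F)) := by
  exact ⟨⟨(isHomeomorph_map_point (A := A)).homeomorph.symm⟩, boxInfHom A, boxInfHom_box,
    fun η' h => HAlg.hom_ext fun a => ContinuousMap.ext fun F =>
      (h a F).trans (boxInfHom_box a F).symm, isHomeomorph_map, isHomeomorph_map_point⟩
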